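/- Let $a_{11}\in\mathbf R$ and $a_{02}>0$, and let $$f_0(u,v)=\tfrac12(0,0,a_{02}v^2)+u\,(1,v,a_{11}v)$$ be the corresponding degenerate quadratic cross cap. A $C^\infty$-map $f$ from a domain of $\mathbf R^2$ to $\mathbf R^3$ has a cross cap singularity at $p$ if there are local $C^\infty$-diffeomorphisms $\phi$ of $(\mathbf R^2,p)$ to $(\mathbf R^2,0)$ and $\Phi$ of $(\mathbf R^3,f(p))$ to $(\mathbf R^3,0)$ with $\Phi\circ f=f_{\mathrm{std}}\circ\phi$ near $p$, where $f_{\mathrm{std}}(u,v)=(u,uv,v^2)$. Two $C^\infty$-maps $\mathbf R^2\to\mathbf R^3$ with cross cap singularities at the origin are isometric if their first fundamental forms (in the same coordinates $u,v$) coincide. Two maps $f,g:\mathbf R^2\to\mathbf R^3$ are congruent if $g=T\circ f$ for an orientation-preserving isometry $T$ of $\mathbf R^3$, and two parametrized curves $c_1,c_2$ in the unit sphere $S^2$ are congruent in $S^2$ if $c_2=A\circ c_1$ for a rotation $A\in SO(3)$. Let $c(s)$ $(|s|<\pi/2)$ be a $C^\infty$-curve in the unit sphere $S^2\subset\mathbf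 R^3$ parametrized by arc length. Set $$\xi(v)=\sqrt{1+(1+a_{11}^2)v^2}\;c\bigl(\arctan(v\sqrt{1+a_{11}^2})\bigr),\qquad B(v)=a_{11}\xi'(v)+\xi(v)\times\xi'(v),$$ $$\gamma(v)=\frac{a_{02}}{1+a_{11}^2}\int_0^v tB(t)\,dt,\qquad f_c(u,v)=\gamma(v)+u\,\xi(v)\qquad (u,v\in\mathbf R).$$ Then: 1. $f_c:\mathbf R^2\to\mathbf R^3$ is $C^\infty$, has a cross cap singularity at the origin, and is isometric to $f_0$ (which also has a cross cap singularity at the origin). 2. If $c_1,c_2$ are two such curves, then $f_{c_1}$ is congruent to $f_{c_2}$ if and only if $c_1$ is congruent to $c_2$ in $S^2$. Moreover, if $f_{c_2}=T\circ f_{c_1}$ for any isometry $T$ of $\mathbf R^3$, orientation-preserving or not, then $f_{c_1}$ and $f_{c_2}$ are congruent. 3. $f_c$ is congruent to $f_0$ if and only if $c$ is a geodesic of $S^2$. 4. Consequently $f_0$ has isometric deformations with infinite-dimensional freedom: for every $N\ge 0$ there is a family $(c_t)_{t\in\mathbf R^N}$ of such curves such that $f_{c_0}=f_0$, the map $(t,u,v)\mapsto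 f_{c_t}(u,v)$ is $C^\infty$, every $f_{c_t}$ is isometric to $f_0$, and $f_{c_t}$ and $f_{c_{t'}}$ are not congruent for $t\ne t'$. -/

import Mathlib

open scoped ContDiff

noncomputable section

namespace CrossCap

/-- Euclidean three-space. -/
abbrev E3 := EuclideanSpace ℝ (Fin 3)

/-- The vector product of Euclidean three-space. -/
def cross (x y : E3) : E3 := WithLp.toLp 2 (crossProduct x.ofLp y.ofLp)

/-- The partial derivative `f_u` of a map of the `(u, v)`-plane. -/
def partialU (f : ℝ × ℝ → E3) (p : ℝ × ℝ) : E3 := fderiv ℝ f p (1, 0)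

/-- The partial derivative `f_v` of a map of the `(u, v)`-plane. -/
def partialV (f : ℝ × ℝ → E3) (p : ℝ × ℝ) : E3 := fderiv ℝ f p (0, 1)

/-- The standard cross cap `(u, v) ↦ (u, uv, v²)`. -/
def fStd (p : ℝ × ℝ) : E3 := !₂[p.1, p.1 * p.2, p.2 ^ 2]

/-- `f` has a cross cap singularity at `p`: there are a local diffeomorphism `φ` of the plane at `p`
and a local diffeomorphism `Φ` of space at `f p`, sending these points to the respective origins,
such that `Φ ∘ f = fStd ∘ φ` near `p`. -/
def IsCrossCapAt (f : ℝ × ℝ → E3) (p : ℝ × ℝ) : Prop :=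
  ∃ (φ : OpenPartialHomeomorph (ℝ × ℝ) (ℝ × ℝ)) (Φ : OpenPartialHomeomorph E3 E3),
    ContDiffOn ℝ ∞ φ φ.source ∧ ContDiffOn ℝ ∞ φ.symm φ.target ∧
    ContDiffOn ℝ ∞ Φ Φ.source ∧ ContDiffOn ℝ ∞ Φ.symm Φ.target ∧
    p ∈ φ.source ∧ φ p = 0 ∧
    f p ∈ Φ.source ∧ Φ (f p) = 0 ∧
    Set.MapsTo f φ.source Φ.source ∧
    ∀ q ∈ φ.source, Φ (f q) = fStd (φ q)

/-- Two smooth maps of the `(u, v)`-plane with a cross cap singularity at the origin are isometric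
if they have the same first fundamental form. -/
structure IsIsometric (f g : ℝ × ℝ → E3) : Prop where
  smooth_left : ContDiff ℝ ∞ f
  smooth_right : ContDiff ℝ ∞ g
  crossCap_left : IsCrossCapAt f 0
  crossCap_right : IsCrossCapAt g 0
  uu : ∀ p, inner ℝ (partialU f p) (partialU f p) = inner ℝ (partialU g p) (partialU g p)
  uv : ∀ p, inner ℝ (partialU f p) (partialV f p) = inner ℝ (partialU g p) (partialV g p)
  vv : ∀ p, inner ℝ (partialV f p) (partialV f p) = inner ℝ (partialV g p) (partialV g p)

/-- An isometric deformation with `N` real parameters: a smooth family all of whose members are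
isometric (as maps with a cross cap singularity at the origin) to the member at `0`. -/
structure IsIsometricDeformation {N : ℕ} (F : EuclideanSpace ℝ (Fin N) → ℝ × ℝ → E3) : Prop where
  smooth : ContDiff ℝ ∞ (fun q : EuclideanSpace ℝ (Fin N) × (ℝ × ℝ) => F q.1 q.2)
  isometric : ∀ t, IsIsometric (F t) (F 0)

/-- Two maps of the plane into space are congruent if they differ by an orientation-preserving
isometry of space. -/
def Congruent (f g : ℝ × ℝ → E3) : Prop :=
  ∃ (A : E3 ≃ₗᵢ[ℝ] E3) (b : E3),
    LinearMap.det (A.toLinearEquiv : E3 →ₗ[ℝ] E3) = 1 ∧ ∀ p, g p = A (f p) + b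

/-- The parameter interval `|s| < π / 2` of the spherical curves. -/
def arcInterval : Set ℝ := Set.Ioo (-(Real.pi / 2)) (Real.pi / 2)

/-- `c`, restricted to `|s| < π / 2`, is a smooth curve in the unit sphere, parametrized by arc
length (hence regular). The values of `c` outside the interval play no role. -/
structure IsSphericalCurve (c : ℝ → E3) : Prop where
  smooth : ContDiffOn ℝ ∞ c arcInterval
  mem_sphere : ∀ s ∈ arcInterval, c s ∈ Metric.sphere (0 : E3) 1
  unit_speed : ∀ s ∈ arcInterval, ‖deriv c s‖ = 1

/-- Two spherical curves on `|s| < π / 2` are congruent if they differ by an orientation-preserving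
isometry of the sphere, that is, by a rotation. -/
def CurveCongruent (c₁ c₂ : ℝ → E3) : Prop :=
  ∃ A : E3 ≃ₗᵢ[ℝ] E3,
    LinearMap.det (A.toLinearEquiv : E3 →ₗ[ℝ] E3) = 1 ∧ ∀ s ∈ arcInterval, c₂ s = A (c₁ s)

/-- A curve in the unit sphere is a geodesic if its covariant acceleration, the part of `c''`
tangent to the sphere, vanishes. -/
def IsSphericalGeodesic (c : ℝ → E3) : Prop :=
  ∀ s ∈ arcInterval, deriv (deriv c) s - inner ℝ (deriv (deriv c) s) (c s) • c s = 0

/-- The degenerate quadratic cross cap with coefficients `a₁₁` and `a₀₂`. -/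
def f₀ (a₁₁ a₀₂ : ℝ) (p : ℝ × ℝ) : E3 :=
  (1 / 2 : ℝ) • !₂[0, 0, a₀₂ * p.2 ^ 2] + p.1 • !₂[1, p.2, a₁₁ * p.2]

/-- `ĉ(v) = c(arctan(v √(1 + a₁₁²)))`. -/
def cHat (a₁₁ : ℝ) (c : ℝ → E3) (v : ℝ) : E3 :=
  c (Real.arctan (v * √(1 + a₁₁ ^ 2)))

/-- `ξ(v) = √(1 + (1 + a₁₁²) v²) ĉ(v)`. -/
def xi (a₁₁ : ℝ) (c : ℝ → E3) (v : ℝ) : E3 :=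
  √(1 + (1 + a₁₁ ^ 2) * v ^ 2) • cHat a₁₁ c v

/-- `B = a₁₁ ξ' + ξ × ξ'`. -/
def B (a₁₁ : ℝ) (c : ℝ → E3) (v : ℝ) : E3 :=
  a₁₁ • deriv (xi a₁₁ c) v + cross (xi a₁₁ c v) (deriv (xi a₁₁ c) v)

/-- `γ(v) = a₀₂ / (1 + a₁₁²) ∫₀ᵛ t B(t) dt`. -/
def gam (a₁₁ a₀₂ : ℝ) (c : ℝ → E3) (v : ℝ) : E3 :=
  (a₀₂ / (1 + a₁₁ ^ 2)) • ∫ t in (0 : ℝ)..v, t • B a₁₁ c t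

/-- The ruled surface `f_c(u, v) = γ(v) + u ξ(v)`. -/
def ruled (a₁₁ a₀₂ : ℝ) (c : ℝ → E3) (p : ℝ × ℝ) : E3 :=
  gam a₁₁ a₀₂ c p.2 + p.1 • xi a₁₁ c p.2

end CrossCap

end

noncomputable section

namespace CrossCap

open MeasureTheory Filter Topology Set

/-! Metric. With `k = 1 + a₁₁²`, arc length gives `⟨ξ, ξ⟩ = 1 + k v²`, `⟨ξ, ξ'⟩ = k v`, `⟨ξ', ξ'⟩ =
k`, and then `|ξ × ξ'|² = k`. So all inner products of `ξ`, `ξ'`, `B` depend on `v` and `a₁₁` alone,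
and every `f_c` has the same first fundamental form (`isIsometric_ruled`). The surface `f₀` is `f_c`
for a great circle (`ruled_greatCircle`).

Singularity. `isCrossCapAt_ruled` treats any ruled surface `f = γ + u ξ` with `γ' = v β` and `ξ(0)`,
`ξ'(0)`, `β(0)` independent. A smooth curve `y ↦ (s(y), v(y))` is found whose points at `±y` have
the same image. By Whitney's theorem on even functions that image is `A(y²)`, while `ξ(v(y)) = P(y²)
+ y Q(y²)`. Hence `f(s(y) + x, v(y)) = A(y²) + x P(y²) + xy Q(y²)`, which is the map `Ψ(z) = A(z₂) +
z₀ P(z₂) + z₁ Q(z₂)` applied to `fStd (x, y)`, and `Ψ` is a local diffeomorphism.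

Congruence. Since `f_c(0) = 0`, an isometry between two such surfaces is linear. It maps rulings to
rulings, hence `ξ₁` to `ξ₂` and `c₁` to `c₂`. The term `ξ × ξ'` in `γ'` detects orientation, so the
determinant is `1`. Geodesics are the curves with `c'' = -c`, all rotations of one great circle.

Deformations. The great circle is left alone for `s ≤ 0` and bent for `s > 0` with a latitude that
encodes `t` in a polynomial. A rotation between two members fixes an arc of the great circle, so it
is the identity, and the latitude returns `t`. -/

/-! ### Smooth dependence of integrals on parameters -/

/-- Domination is by the maximum of `F'` over a closed unit ball times the interval, which is
compact because `X` is proper. -/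
theorem hasFDerivAt_parametric_intervalIntegral {X E : Type} [NormedAddCommGroup X]
    [NormedSpace ℝ X] [ProperSpace X] [NormedAddCommGroup E] [NormedSpace ℝ E]
    {F : X → ℝ → E} {F' : X → ℝ → X →L[ℝ] E} (hF : Continuous (Function.uncurry F))
    (hF' : Continuous (Function.uncurry F'))
    (hd : ∀ x t, HasFDerivAt (fun x => F x t) (F' x t) x) (a b : ℝ) (x₀ : X) :
    HasFDerivAt (fun x => ∫ t in a..b, F x t) (∫ t in a..b, F' x₀ t) x₀ := by
  obtain ⟨C, hC⟩ := ((isCompact_closedBall x₀ 1).prod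
    (isCompact_uIcc (a := a) (b := b))).exists_bound_of_continuousOn hF'.continuousOn
  have hc : ∀ x, Continuous (F x) := fun x => hF.comp (Continuous.prodMk_right x)
  have hc' : ∀ x, Continuous (F' x) := fun x => hF'.comp (Continuous.prodMk_right x)
  refine intervalIntegral.hasFDerivAt_integral_of_dominated_of_fderiv_le (bound := fun _ => C)
    (Metric.closedBall_mem_nhds x₀ one_pos)
    (Eventually.of_forall fun x => (hc x).aestronglyMeasurable)
    ((hc x₀).intervalIntegrable _ _) (hc' x₀).aestronglyMeasurable
    (Eventually.of_forall fun t ht x hx => ?_) intervalIntegrable_const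
    (Eventually.of_forall fun t _ x _ => hd x t)
  exact hC (x, t) ⟨hx, uIoc_subset_uIcc ht⟩

/-- `E` is quantified after `n` because the induction passes to a derivative with values in `X →L[ℝ]
E`. -/
theorem contDiff_nat_parametric_intervalIntegral {X : Type} [NormedAddCommGroup X]
    [NormedSpace ℝ X] [ProperSpace X] (a b : ℝ) (n : ℕ) :
    ∀ {E : Type} [NormedAddCommGroup E] [NormedSpace ℝ E] {F : X × ℝ → E},
      ContDiff ℝ n F → ContDiff ℝ n (fun x => ∫ t in a..b, F (x, t)) := by
  induction n with
  | zero =>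
    intro E _ _ F hF
    rw [Nat.cast_zero, contDiff_zero] at hF ⊢
    exact intervalIntegral.continuous_parametric_intervalIntegral_of_continuous'
      (f := fun x t => F (x, t)) hF a b
  | succ n ih =>
    intro E _ _ F hF
    have hF1 : ContDiff ℝ ((n : ℕ) + 1 : WithTop ℕ∞) F := by exact_mod_cast hF
    have hd : ContDiff ℝ n (fun q : X × ℝ =>
        (fderiv ℝ F q).comp (ContinuousLinearMap.inl ℝ X ℝ)) :=
      (contDiff_succ_iff_fderiv.1 hF1).2.2.clm_comp contDiff_const
    have hdiff : Differentiable ℝ F := (contDiff_succ_iff_fderiv.1 hF1).1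
    push_cast
    rw [contDiff_succ_iff_hasFDerivAt]
    refine ⟨fun x => ∫ t in a..b, (fderiv ℝ F (x, t)).comp (ContinuousLinearMap.inl ℝ X ℝ),
      ih hd, fun x => ?_⟩
    refine hasFDerivAt_parametric_intervalIntegral (F := fun x t => F (x, t))
      (F' := fun x t => (fderiv ℝ F (x, t)).comp (ContinuousLinearMap.inl ℝ X ℝ))
      hF.continuous hd.continuous (fun x t => ?_) a b x
    exact (hdiff (x, t)).hasFDerivAt.comp x (hasFDerivAt_prodMk_left x t)

/-- Integrals of a smooth map with respect to one of its variables depend smoothly on the others. -/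
theorem contDiff_parametric_intervalIntegral {X E : Type} [NormedAddCommGroup X]
    [NormedSpace ℝ X] [ProperSpace X] [NormedAddCommGroup E] [NormedSpace ℝ E] {F : X × ℝ → E}
    (hF : ContDiff ℝ ∞ F) (a b : ℝ) : ContDiff ℝ ∞ (fun x => ∫ t in a..b, F (x, t)) :=
  contDiff_infty.2 fun n => contDiff_nat_parametric_intervalIntegral a b n (contDiff_infty.1 hF n)

/-- A primitive of a smooth map in one of its variables is smooth in all of them. -/
theorem contDiff_parametric_primitive {X E : Type} [NormedAddCommGroup X]
    [NormedSpace ℝ X] [ProperSpace X] [NormedAddCommGroup E] [NormedSpace ℝ E] {F : X × ℝ → E}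
    (hF : ContDiff ℝ ∞ F) : ContDiff ℝ ∞ (fun q : X × ℝ => ∫ t in (0 : ℝ)..q.2, F (q.1, t)) := by
  -- Rescaling to `[0, 1]` moves the variable endpoint into the integrand.
  have h : (fun q : X × ℝ => ∫ t in (0 : ℝ)..q.2, F (q.1, t)) =
      fun q => q.2 • ∫ t in (0 : ℝ)..1, F (q.1, q.2 * t) := by
    funext q
    rw [intervalIntegral.smul_integral_comp_mul_left (fun t => F (q.1, t))]
    simp
  rw [h]
  exact contDiff_snd.smul (contDiff_parametric_intervalIntegral
    (F := fun r : (X × ℝ) × ℝ => F (r.1.1, r.1.2 * r.2)) (by fun_prop) 0 1)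

/-! ### Borel's lemma and Whitney's theorem on even functions -/

/-- **Borel's lemma**: every sequence is the sequence of derivatives at `0` of a smooth function. -/
theorem exists_contDiff_iteratedDeriv_zero_eq {E : Type*} [NormedAddCommGroup E] [NormedSpace ℝ E]
    [CompleteSpace E] (a : ℕ → E) :
    ∃ b : ℝ → E, ContDiff ℝ ∞ b ∧ ∀ n, iteratedDeriv n b 0 = a n := by
  obtain ⟨χ⟩ : Nonempty (ContDiffBump (0 : ℝ)) := inferInstance
  let p : ℕ → ℝ → ℝ := fun k x => ((k.factorial : ℝ)⁻¹ * x ^ k) * χ x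
  have hp : ∀ k, ContDiff ℝ ∞ (p k) := fun k =>
    (contDiff_const.mul (contDiff_id.pow k)).mul χ.contDiff
  have hsupp : ∀ k, HasCompactSupport (p k) := fun k => χ.hasCompactSupport.mul_left
  have hbound : ∀ k j : ℕ, ∃ M : ℝ, ∀ x, ‖iteratedDeriv j (p k) x‖ ≤ M := fun k j => by
    have hs : HasCompactSupport (iteratedFDeriv ℝ j (p k)) := (hsupp k).iteratedFDeriv j
    obtain ⟨M, hM⟩ := hs.exists_bound_of_continuous
      ((hp k).continuous_iteratedFDeriv (mod_cast le_top))
    exact ⟨M, fun x => by rw [← norm_iteratedFDeriv_eq_norm_iteratedDeriv]; exact hM x⟩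
  choose M hM using hbound
  have hM0 : ∀ k j, 0 ≤ M k j := fun k j => (norm_nonneg _).trans (hM k j 0)
  let C : ℕ → ℝ := fun k => ∑ j ∈ Finset.range k, M k j
  have hC0 : ∀ k, 0 ≤ C k := fun k => Finset.sum_nonneg fun j _ => hM0 k j
  -- `l k ≥ 1` makes spare negative powers harmless, and `l k ≥ 2 ^ k * (C k * ‖a k‖)` pushes the
  -- derivatives of order `j < k` of the `k`-th term below `2⁻ᵏ`.
  let l : ℕ → ℝ := fun k => 1 + 2 ^ k * (C k * ‖a k‖)
  have hl1 : ∀ k, 1 ≤ l k := fun k => by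
    have := hC0 k
    simp only [l, le_add_iff_nonneg_right]
    positivity
  have hl0 : ∀ k, 0 < l k := fun k => one_pos.trans_le (hl1 k)
  -- The prefactor cancels the rescaling in the `k`-th derivative at `0`, which stays equal to `a
  -- k`.
  let f : ℕ → ℝ → E := fun k w => (((l k)⁻¹ ^ k) * p k (l k * w)) • a k
  have hf : ∀ k, ContDiff ℝ ∞ (f k) := fun k =>
    (contDiff_const.mul ((hp k).comp (contDiff_const.mul contDiff_id))).smul contDiff_const
  have hder : ∀ k j w, iteratedDeriv j (f k) w =
      ((l k)⁻¹ ^ k * (l k ^ j * iteratedDeriv j (p k) (l k * w))) • a k := fun k j w => by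
    have h1 : ContDiff ℝ j (fun w => p k (l k * w)) :=
      ((hp k).comp (contDiff_const.mul contDiff_id)).of_le (mod_cast le_top)
    have h2 : ContDiff ℝ j (fun w => (l k)⁻¹ ^ k * p k (l k * w)) := contDiff_const.mul h1
    rw [show f k = fun w => ((l k)⁻¹ ^ k * p k (l k * w)) • a k from rfl]
    rw [iteratedDeriv_smul_const h2.contDiffAt, iteratedDeriv_const_mul_field,
      iteratedDeriv_comp_const_mul ((hp k).of_le (mod_cast le_top))]
  -- For fixed `j` only finitely many `k` satisfy `k ≤ j`; their bounds do not affect summability.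
  let v : ℕ → ℕ → ℝ := fun j k => if j < k then (1 / 2) ^ k else
    (l k)⁻¹ ^ k * (l k ^ j * M k j) * ‖a k‖
  have hv : ∀ j, Summable (v j) := fun j => by
    refine (summable_congr_cofinite (f := fun k : ℕ => ((1 : ℝ) / 2) ^ k) ?_).1
      (summable_geometric_of_lt_one (by norm_num) (by norm_num))
    rw [Nat.cofinite_eq_atTop]
    filter_upwards [eventually_gt_atTop j] with k hk
    simp [v, hk]
  have hfv : ∀ (j k : ℕ) (w : ℝ), ‖iteratedFDeriv ℝ j (f k) w‖ ≤ v j k := fun j k w => by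
    have hlk := hl0 k
    have h1 : ‖iteratedFDeriv ℝ j (f k) w‖ ≤ (l k)⁻¹ ^ k * (l k ^ j * M k j) * ‖a k‖ := by
      rw [norm_iteratedFDeriv_eq_norm_iteratedDeriv, hder, norm_smul, norm_mul, norm_mul, norm_pow,
        norm_pow, norm_inv, Real.norm_of_nonneg hlk.le]
      gcongr
      exact hM k j _
    by_cases hjk : j < k
    · simp only [v, hjk, if_true]
      refine h1.trans ?_
      have h2 : (l k)⁻¹ ^ k * l k ^ j ≤ (l k)⁻¹ := by
        obtain ⟨d, rfl⟩ := Nat.exists_eq_add_of_lt hjk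
        have : (l (j + d + 1))⁻¹ ^ (j + d + 1) * l (j + d + 1) ^ j =
            (l (j + d + 1))⁻¹ * (l (j + d + 1))⁻¹ ^ d := by
          rw [pow_succ, pow_add, mul_comm, ← mul_assoc, ← mul_assoc, ← mul_pow,
            mul_inv_cancel₀ hlk.ne', one_pow, one_mul, mul_comm]
        rw [this]
        exact mul_le_of_le_one_right (by positivity)
          (pow_le_one₀ (by positivity) (inv_le_one_of_one_le₀ (hl1 _)))
      have h3 : M k j ≤ C k := Finset.single_le_sum (f := fun j => M k j)
        (fun j _ => hM0 k j) (Finset.mem_range.2 hjk)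
      calc (l k)⁻¹ ^ k * (l k ^ j * M k j) * ‖a k‖
          = ((l k)⁻¹ ^ k * l k ^ j) * (M k j * ‖a k‖) := by ring
        _ ≤ (l k)⁻¹ * (C k * ‖a k‖) := by
            have := hM0 k j
            gcongr
        _ ≤ (1 / 2) ^ k := by
            rw [inv_mul_le_iff₀ hlk]
            have : l k * (1 / 2) ^ k = (1 / 2) ^ k + C k * ‖a k‖ := by
              simp only [l, one_div, inv_pow]
              field_simp
            rw [this]
            have : (0 : ℝ) < (1 / 2) ^ k := by positivity
            linarith
    · simpa only [v, hjk, if_false] using h1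
  refine ⟨fun w => ∑' k, f k w, contDiff_tsum (N := ⊤) (v := v) hf (fun j _ => hv j)
    (fun j k w _ => hfv j k w), fun n => ?_⟩
  have hsum : Summable fun k => iteratedFDeriv ℝ n (f k) 0 :=
    Summable.of_norm_bounded (hv n) fun k => hfv n k 0
  rw [iteratedDeriv_eq_iteratedFDeriv, iteratedFDeriv_tsum_apply (N := ⊤) (v := v) hf
    (fun j _ => hv j) (fun j k w _ => hfv j k w) le_top]
  have hev := (ContinuousMultilinearMap.apply ℝ (fun _ : Fin n => ℝ) E (fun _ => 1)).map_tsum hsum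
  simp only [ContinuousMultilinearMap.apply_apply] at hev
  rw [hev]
  have hval : ∀ k, iteratedDeriv n (p k) 0 = if n = k then 1 else 0 := fun k => by
    have hev : p k =ᶠ[𝓝 0] fun x => (k.factorial : ℝ)⁻¹ * x ^ k := by
      filter_upwards [χ.eventuallyEq_one] with x hx
      simp [p, hx]
    rw [hev.iteratedDeriv_eq, iteratedDeriv_const_mul_field, iteratedDeriv_fun_pow_zero]
    split_ifs with h
    · subst h
      exact inv_mul_cancel₀ (by positivity)
    · simp
  rw [tsum_eq_single n]
  · rw [← iteratedDeriv_eq_iteratedFDeriv, hder, mul_zero, hval, if_pos rfl, mul_one, ← mul_pow,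
      inv_mul_cancel₀ (hl0 n).ne', one_pow, one_smul]
  · intro k hk
    rw [← iteratedDeriv_eq_iteratedFDeriv, hder, mul_zero, hval, if_neg hk.symm]
    simp

/-- For even `h` this is `h'(y) / (2 y)`, extended smoothly to `y = 0`. -/
def evenQuotient {E : Type} [NormedAddCommGroup E] [NormedSpace ℝ E] (h : ℝ → E) (y : ℝ) : E :=
  (1 / 2 : ℝ) • ∫ t in (0 : ℝ)..1, deriv (deriv h) (y * t)

section Even

variable {E : Type} [NormedAddCommGroup E] [NormedSpace ℝ E]

theorem contDiff_deriv {h : ℝ → E} (hh : ContDiff ℝ ∞ h) : ContDiff ℝ ∞ (deriv h) :=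
  (contDiff_infty_iff_deriv.1 hh).2

theorem hasDerivAt_of_contDiff {h : ℝ → E} (hh : ContDiff ℝ ∞ h) (x : ℝ) :
    HasDerivAt h (deriv h x) x :=
  ((contDiff_infty_iff_deriv.1 hh).1 x).hasDerivAt

theorem deriv_neg_eq_of_even {h : ℝ → E} (he : ∀ y, h (-y) = h y) (y : ℝ) :
    deriv h (-y) = -deriv h y := by
  have := deriv_comp_neg h y
  rw [funext he] at this
  rw [this, neg_neg]

theorem deriv_neg_eq_of_odd {h : ℝ → E} (ho : ∀ y, h (-y) = -h y) (y : ℝ) :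
    deriv h (-y) = deriv h y := by
  have := deriv_comp_neg h y
  rw [funext ho, deriv.fun_neg] at this
  exact (neg_injective this).symm

theorem contDiff_evenQuotient {h : ℝ → E} (hh : ContDiff ℝ ∞ h) :
    ContDiff ℝ ∞ (evenQuotient h) := by
  have h2 := contDiff_deriv (contDiff_deriv hh)
  exact contDiff_const.smul (contDiff_parametric_intervalIntegral
    (F := fun q : ℝ × ℝ => deriv (deriv h) (q.1 * q.2)) (by fun_prop) 0 1)

theorem evenQuotient_neg {h : ℝ → E} (he : ∀ y, h (-y) = h y) (y : ℝ) :
    evenQuotient h (-y) = evenQuotient h y := by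
  simp only [evenQuotient, neg_mul, deriv_neg_eq_of_odd (deriv_neg_eq_of_even he)]

variable [CompleteSpace E]

theorem eq_add_smul_integral_deriv {h : ℝ → E} (hh : ContDiff ℝ ∞ h) (y : ℝ) :
    h y = h 0 + y • ∫ t in (0 : ℝ)..1, deriv h (y * t) := by
  rw [intervalIntegral.smul_integral_comp_mul_left (deriv h), mul_zero, mul_one,
    intervalIntegral.integral_deriv_eq_sub (fun x _ => (hasDerivAt_of_contDiff hh x).differentiableAt)
      ((contDiff_deriv hh).continuous.intervalIntegrable _ _)]
  abel

theorem deriv_eq_smul_evenQuotient {h : ℝ → E} (hh : ContDiff ℝ ∞ h) (he : ∀ y, h (-y) = h y)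
    (y : ℝ) : deriv h y = (2 * y) • evenQuotient h y := by
  have h0 : deriv h 0 = 0 := by
    have := deriv_neg_eq_of_even he 0
    rw [neg_zero, eq_neg_iff_add_eq_zero, ← two_smul ℝ] at this
    exact (smul_eq_zero.1 this).resolve_left two_ne_zero
  rw [eq_add_smul_integral_deriv (contDiff_deriv hh) y, h0, zero_add, evenQuotient, smul_smul]
  congr 1
  ring

/-- **Whitney's theorem on even functions**: a smooth even function is a smooth function of the
square. -/
theorem exists_contDiff_comp_sq_of_even {h : ℝ → E} (hh : ContDiff ℝ ∞ h)
    (he : ∀ y, h (-y) = h y) : ∃ g : ℝ → E, ContDiff ℝ ∞ g ∧ ∀ y, h y = g (y ^ 2) := by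
  -- As `d/d(y²) = (2y)⁻¹ d/dy`, `H n` is the `n`-th derivative of the sought `g`, evaluated at
  -- `y²`.
  let H : ℕ → ℝ → E := fun n => evenQuotient^[n] h
  have hH : ∀ n, ContDiff ℝ ∞ (H n) ∧ ∀ y, H n (-y) = H n y := fun n => by
    induction n with
    | zero => exact ⟨hh, he⟩
    | succ n ih =>
      simp only [H, Function.iterate_succ_apply']
      exact ⟨contDiff_evenQuotient ih.1, evenQuotient_neg ih.2⟩
  have hH' : ∀ n y, HasDerivAt (H n) ((2 * y) • H (n + 1) y) y := fun n y => by
    have := hasDerivAt_of_contDiff (hH n).1 y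
    rw [deriv_eq_smul_evenQuotient (hH n).1 (hH n).2] at this
    simpa only [H, Function.iterate_succ_apply'] using this
  -- On negative numbers `g` is free except for its jet at `0`; Borel's lemma provides a function
  -- with that jet.
  obtain ⟨b, hb, hb0⟩ := exists_contDiff_iteratedDeriv_zero_eq fun n => H n 0
  have hbn : ∀ n, ContDiff ℝ ∞ (iteratedDeriv n b) := fun n => by
    induction n with
    | zero => simpa using hb
    | succ n ih => rw [iteratedDeriv_succ]; exact contDiff_deriv ih
  let G : ℕ → ℝ → E := fun n w => if 0 ≤ w then H n √w else iteratedDeriv n b w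
  have hGc : ∀ n, Continuous (G n) := fun n => by
    refine Continuous.if_le ((hH n).1.continuous.comp Real.continuous_sqrt) (hbn n).continuous
      continuous_const continuous_id fun w hw => ?_
    rw [← hw, Real.sqrt_zero, hb0]
  have hGd : ∀ n w, HasDerivAt (G n) (G (n + 1) w) w := fun n => by
    have hne : ∀ w, w ≠ 0 → HasDerivAt (G n) (G (n + 1) w) w := fun w hw => by
      rcases lt_or_gt_of_ne hw with hw | hw
      · have h1 : HasDerivAt (iteratedDeriv n b) (iteratedDeriv (n + 1) b w) w := by
          rw [iteratedDeriv_succ]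
          exact hasDerivAt_of_contDiff (hbn n) w
        have h2 : G (n + 1) w = iteratedDeriv (n + 1) b w := if_neg hw.not_ge
        rw [h2]
        refine h1.congr_of_eventuallyEq ?_
        filter_upwards [gt_mem_nhds hw] with x hx
        exact if_neg hx.not_ge
      · have h1 := (hH' n √w).scomp w (Real.hasDerivAt_sqrt hw.ne')
        have h2 : G (n + 1) w = H (n + 1) √w := if_pos hw.le
        have h3 : (1 / (2 * √w)) • (2 * √w) • H (n + 1) √w = H (n + 1) √w := by
          have : 0 < √w := Real.sqrt_pos.2 hw
          rw [smul_smul, one_div, inv_mul_cancel₀ (by positivity), one_smul]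
        rw [h2, ← h3]
        refine h1.congr_of_eventuallyEq ?_
        filter_upwards [lt_mem_nhds hw] with x hx
        exact if_pos hx.le
    intro w
    -- At the seam `w = 0`, continuity of `G n` and `G (n + 1)` suffices for differentiability.
    exact hasDerivAt_of_hasDerivAt_of_ne' (fun y hy => hne y hy) (hGc n).continuousAt
      (hGc (n + 1)).continuousAt w
  have hGs : ∀ (m n : ℕ), ContDiff ℝ m (G n) := fun m => by
    induction m with
    | zero => exact fun n => by simpa using contDiff_zero (𝕜 := ℝ).2 (hGc n)
    | succ m ih =>
      intro n
      push_cast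
      rw [contDiff_succ_iff_deriv]
      refine ⟨fun w => (hGd n w).differentiableAt, by simp, ?_⟩
      rw [show deriv (G n) = G (n + 1) from funext fun w => (hGd n w).deriv]
      exact ih (n + 1)
  refine ⟨G 0, contDiff_infty.2 fun m => hGs m 0, fun y => ?_⟩
  have : G 0 (y ^ 2) = H 0 |y| := by
    rw [← Real.sqrt_sq_eq_abs]
    exact if_pos (sq_nonneg y)
  rw [this]
  rcases abs_choice y with hy | hy
  · rw [hy]; rfl
  · rw [hy]; exact (he y).symm

/-- Every smooth function is the sum of a smooth function of `y²` and `y` times such a function. -/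
theorem exists_contDiff_even_odd_decomposition {h : ℝ → E} (hh : ContDiff ℝ ∞ h) :
    ∃ g₀ g₁ : ℝ → E, ContDiff ℝ ∞ g₀ ∧ ContDiff ℝ ∞ g₁ ∧
      ∀ y, h y = g₀ (y ^ 2) + y • g₁ (y ^ 2) := by
  obtain ⟨g₀, hg₀, h₀⟩ := exists_contDiff_comp_sq_of_even
    (h := fun y => (1 / 2 : ℝ) • (h y + h (-y))) (by fun_prop)
    (fun y => by rw [neg_neg, add_comm])
  -- The odd part is `y` times the integral of `o' (y t)`, and this integral is even in `y`.
  let o : ℝ → E := fun y => (1 / 2 : ℝ) • (h y - h (-y))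
  have ho : ContDiff ℝ ∞ o := by fun_prop
  have ho' : ∀ y, o (-y) = -o y := fun y => by
    simp only [o, neg_neg, ← smul_neg, neg_sub]
  have hd := contDiff_deriv ho
  obtain ⟨g₁, hg₁, h₁⟩ := exists_contDiff_comp_sq_of_even
    (h := fun y => ∫ t in (0 : ℝ)..1, deriv o (y * t))
    (contDiff_parametric_intervalIntegral
      (F := fun q : ℝ × ℝ => deriv o (q.1 * q.2)) (by fun_prop) 0 1)
    (fun y => by simp only [neg_mul, deriv_neg_eq_of_odd ho'])
  refine ⟨g₀, g₁, hg₀, hg₁, fun y => ?_⟩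
  have h2 : o y = y • g₁ (y ^ 2) := by
    rw [← h₁, eq_add_smul_integral_deriv ho y]
    simp [o]
  rw [← h₀, ← h2]
  simp only [o, ← smul_add, add_add_sub_cancel]
  rw [← two_smul ℝ (h y), smul_smul]
  norm_num

end Even

/-! ### Inverse function theorem and smooth extension -/

/-- The smooth inverse function theorem. -/
theorem exists_openPartialHomeomorph_of_contDiff {X Y : Type*} [NormedAddCommGroup X]
    [NormedSpace ℝ X] [CompleteSpace X] [NormedAddCommGroup Y] [NormedSpace ℝ Y]
    {F : X → Y} (hF : ContDiff ℝ ∞ F) {a : X} (L : X ≃L[ℝ] Y)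
    (hL : HasFDerivAt F (L : X →L[ℝ] Y) a) :
    ∃ e : OpenPartialHomeomorph X Y, (∀ x, e x = F x) ∧ a ∈ e.source ∧
      ContDiffOn ℝ ∞ e.symm e.target := by
  let e₀ := hF.contDiffAt.toOpenPartialHomeomorph F hL (by simp)
  have ha : a ∈ e₀.source := hF.contDiffAt.mem_toOpenPartialHomeomorph_source hL (by simp)
  -- Restriction to the open set of invertible derivatives makes the inverse smooth on the entire
  -- target.
  let U : Set X := fderiv ℝ F ⁻¹' Set.range ((↑) : (X ≃L[ℝ] Y) → X →L[ℝ] Y)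
  have hU : IsOpen U := (ContinuousLinearEquiv.isOpen (𝕜 := ℝ) (E := X) (F := Y)).preimage
    (hF.continuous_fderiv (by simp))
  refine ⟨e₀.restrOpen U hU, fun x => rfl, ⟨ha, L, hL.fderiv.symm⟩, fun y hy => ?_⟩
  have hy' : y ∈ e₀.target ∧ e₀.symm y ∈ U := by simpa using hy
  obtain ⟨L', hL'⟩ := hy'.2
  refine ContDiffAt.contDiffWithinAt ?_
  refine e₀.contDiffAt_symm (f₀' := L') hy'.1 ?_ hF.contDiffAt
  rw [hL']
  exact (hF.differentiable (by simp) _).hasFDerivAt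

theorem exists_openPartialHomeomorph_of_injective_fderiv {X Y : Type*} [NormedAddCommGroup X]
    [NormedSpace ℝ X] [FiniteDimensional ℝ X] [NormedAddCommGroup Y] [NormedSpace ℝ Y]
    [FiniteDimensional ℝ Y] (hdim : Module.finrank ℝ X = Module.finrank ℝ Y)
    {F : X → Y} (hF : ContDiff ℝ ∞ F) {a : X}
    (hinj : ∀ x, fderiv ℝ F a x = 0 → x = 0) :
    ∃ e : OpenPartialHomeomorph X Y, (∀ x, e x = F x) ∧ a ∈ e.source ∧
      ContDiffOn ℝ ∞ e.symm e.target := by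
  have : CompleteSpace X := FiniteDimensional.complete ℝ X
  let L := (LinearMap.linearEquivOfInjective (fderiv ℝ F a : X →ₗ[ℝ] Y)
    ((injective_iff_map_eq_zero _).2 hinj) hdim).toContinuousLinearEquiv
  have hL : (L : X →L[ℝ] Y) = fderiv ℝ F a := by
    ext x
    exact LinearMap.linearEquivOfInjective_apply ((injective_iff_map_eq_zero _).2 hinj) hdim x
  refine exists_openPartialHomeomorph_of_contDiff hF L ?_
  rw [hL]
  exact (hF.differentiable (by simp) _).hasFDerivAt

theorem fderiv_apply_eq_of_hasDerivAt {X Y : Type*} [NormedAddCommGroup X]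
    [NormedSpace ℝ X] [NormedAddCommGroup Y] [NormedSpace ℝ Y] {F : X → Y}
    (hF : ContDiff ℝ ∞ F) {x : X} {y : Y}
    (h : HasDerivAt (fun t : ℝ => F (t • x)) y 0) : fderiv ℝ F 0 x = y := by
  have h1 : HasFDerivAt F (fderiv ℝ F 0) ((0 : ℝ) • x) := by
    rw [zero_smul]
    exact (hF.differentiable (by simp) _).hasFDerivAt
  have h2 : HasDerivAt (fun t : ℝ => t • x) x 0 := by
    simpa using (hasDerivAt_id (0 : ℝ)).smul_const x
  exact (h1.comp_hasDerivAt (0 : ℝ) h2).unique h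

/-- A function that is smooth near a point agrees near it with a globally smooth one. -/
theorem exists_contDiff_eventuallyEq {X Y : Type*} [NormedAddCommGroup X] [NormedSpace ℝ X]
    [FiniteDimensional ℝ X] [NormedAddCommGroup Y] [NormedSpace ℝ Y] {S : X → Y} {U : Set X}
    (hU : IsOpen U) (hS : ContDiffOn ℝ ∞ S U) {a : X} (ha : a ∈ U) :
    ∃ S' : X → Y, ContDiff ℝ ∞ S' ∧ S' =ᶠ[𝓝 a] S := by
  obtain ⟨r, hr, hrU⟩ := Metric.isOpen_iff.1 hU a ha
  let χ : ContDiffBump a := ⟨r / 4, r / 2, by positivity, by linarith⟩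
  refine ⟨fun x => χ x • S x, contDiff_iff_contDiffAt.2 fun x => ?_, ?_⟩
  · by_cases hx : x ∈ tsupport fun x => χ x • S x
    swap
    · exact contDiffAt_const.congr_of_eventuallyEq (notMem_tsupport_iff_eventuallyEq.1 hx)
    have hx' : x ∈ U := by
      have h1 := closure_mono (Function.support_smul_subset_left (χ : X → ℝ) S) hx
      have h2 : x ∈ Metric.closedBall a (r / 2) := by
        rw [← χ.tsupport_eq]
        exact h1
      exact hrU (Metric.closedBall_subset_ball (by linarith) h2)
    exact χ.contDiff.contDiffAt.smul (hS.contDiffAt (hU.mem_nhds hx'))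
  · filter_upwards [χ.eventuallyEq_one] with x hx
    simp [hx]

/-! ### Cross cap singularities of ruled surfaces -/

/-- The mean value of `g` on the interval with centre `q.1` and radius `q.2`. -/
def centralMean (g : ℝ → E3) (q : ℝ × ℝ) : E3 :=
  (1 / 2 : ℝ) • ∫ t in (-1 : ℝ)..1, g (q.1 + q.2 * t)

theorem contDiff_centralMean {g : ℝ → E3} (hg : ContDiff ℝ ∞ g) :
    ContDiff ℝ ∞ (centralMean g) :=
  (contDiff_parametric_intervalIntegral
    (F := fun q : (ℝ × ℝ) × ℝ => g (q.1.1 + q.1.2 * q.2)) (by fun_prop) (-1) 1).const_smul _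

theorem centralMean_zero_right (g : ℝ → E3) (m : ℝ) : centralMean g (m, 0) = g m := by
  simp only [centralMean, zero_mul, add_zero, intervalIntegral.integral_const, smul_smul]
  norm_num

theorem centralMean_neg_right (g : ℝ → E3) (m y : ℝ) :
    centralMean g (m, -y) = centralMean g (m, y) := by
  have := intervalIntegral.integral_comp_neg (a := -1) (b := 1) (fun t => g (m + y * t))
  simp only [neg_neg, mul_neg] at this
  simp only [centralMean, neg_mul, this]

/-- This makes `centralMean g` the smooth extension of `(h(m + y) - h(m - y)) / (2y)` across `y =
0`. -/
theorem smul_centralMean {g h : ℝ → E3} (hg : Continuous g) (hh : ∀ v, HasDerivAt h (g v) v)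
    (m y : ℝ) : (2 * y) • centralMean g (m, y) = h (m + y) - h (m - y) := by
  have h1 := intervalIntegral.smul_integral_comp_add_mul (a := -1) (b := 1) g y m
  have h2 := intervalIntegral.integral_eq_sub_of_hasDerivAt (a := m + y * -1) (b := m + y * 1)
    (fun x _ => hh x) (hg.intervalIntegrable _ _)
  rw [h2] at h1
  rw [centralMean, smul_smul, show 2 * y * (1 / 2) = y by ring, h1]
  simp [sub_eq_add_neg]

/-- A triple of coefficients with vanishing linear combination of independent vectors vanishes. -/
theorem eq_zero_of_linearIndependent {x y z : E3} (h : LinearIndependent ℝ ![x, y, z])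
    {a b c : ℝ} (hs : a • x + b • y + c • z = 0) : a = 0 ∧ b = 0 ∧ c = 0 := by
  have := Fintype.linearIndependent_iff.1 h ![a, b, c] (by simpa [Fin.sum_univ_three] using hs)
  exact ⟨this 0, this 1, this 2⟩

section Ruled

variable {γ ξ β : ℝ → E3}

/-- The curve of double points of a ruled surface near a cross cap singularity. -/
theorem exists_doublePointCurve (hξ : ContDiff ℝ ∞ ξ) (hβ : ContDiff ℝ ∞ β)
    (hγ' : ∀ v, HasDerivAt γ (v • β v) v)
    (hli : LinearIndependent ℝ ![ξ 0, deriv ξ 0, β 0]) :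
    ∃ v s : ℝ → ℝ, ContDiff ℝ ∞ v ∧ ContDiff ℝ ∞ s ∧ v 0 = 0 ∧ deriv v 0 = 1 ∧ s 0 = 0 ∧
      ∀ᶠ y in 𝓝 0, γ (v (-y)) + s (-y) • ξ (v (-y)) = γ (v y) + s y • ξ (v y) := by
  let g : ℝ → E3 := fun t => t • β t
  have hg : ContDiff ℝ ∞ g := contDiff_id.smul hβ
  have hξ1 : ContDiff ℝ ∞ (deriv ξ) := contDiff_deriv hξ
  -- Ansatz `v = m + y`, `s = p + y q` with `m`, `p`, `q` even in `y`. For `y ≠ 0`, `W` is the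
  -- difference of the image points at `y` and `-y`, divided by `2y`; the division removes the
  -- trivial solution branch `y = 0`.
  let W : ℝ × (ℝ × ℝ × ℝ) → E3 := fun z =>
    centralMean g (z.2.1, z.1) + z.2.2.1 • centralMean (deriv ξ) (z.2.1, z.1) +
      z.2.2.2 • ((1 / 2 : ℝ) • (ξ (z.2.1 + z.1) + ξ (z.2.1 - z.1)))
  have hW : ContDiff ℝ ∞ W := by
    have h1 := contDiff_centralMean hg
    have h2 := contDiff_centralMean hξ1
    fun_prop
  have hWneg : ∀ y z, W (-y, z) = W (y, z) := fun y z => by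
    simp only [W, centralMean_neg_right, sub_neg_eq_add, ← sub_eq_add_neg]
    rw [add_comm (ξ (z.1 - y))]
  -- Keeping `y` as a coordinate reduces solving `W = 0` for `(m, p, q)` to inverting `F`.
  let F : ℝ × (ℝ × ℝ × ℝ) → ℝ × E3 := fun z => (z.1, W z)
  have hF : ContDiff ℝ ∞ F := contDiff_fst.prodMk hW
  have hF0 : F 0 = 0 := by
    have : W 0 = 0 := by
      simp only [W, Prod.fst_zero, Prod.snd_zero, centralMean_zero_right, zero_smul, add_zero, g]
    simp [F, this]
  have hinj : ∀ z, fderiv ℝ F 0 z = 0 → z = 0 := by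
    rintro ⟨y, m, p, q⟩ hz
    have h1 : HasFDerivAt F ((ContinuousLinearMap.fst ℝ _ _).prod (fderiv ℝ W 0)) 0 :=
      hasFDerivAt_fst.prodMk (hW.differentiable (by simp) _).hasFDerivAt
    rw [h1.fderiv] at hz
    have hy : y = 0 := congrArg Prod.fst hz
    subst hy
    have hz2 : fderiv ℝ W 0 (0, m, p, q) = 0 := congrArg Prod.snd hz
    have h2 : fderiv ℝ W 0 (0, m, p, q) = q • ξ 0 + p • deriv ξ 0 + m • β 0 := by
      refine fderiv_apply_eq_of_hasDerivAt hW ?_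
      have hWt : (fun t : ℝ => W (t • (0, m, p, q))) = fun t =>
          (t * m) • β (t * m) + (t * p) • deriv ξ (t * m) + (t * q) • ξ (t * m) := by
        funext t
        simp only [W, g, Prod.smul_mk, smul_eq_mul, mul_zero, centralMean_zero_right, add_zero,
          sub_zero]
        rw [← two_smul ℝ (ξ _), smul_smul (1 / 2 : ℝ)]
        norm_num
      have hm : ∀ r : ℝ, HasDerivAt (fun t : ℝ => t * r) r 0 := fun r => by
        simpa using (hasDerivAt_id (0 : ℝ)).mul_const r
      have hc : ∀ {u : ℝ → E3} (_ : ContDiff ℝ ∞ u) (r : ℝ),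
          HasDerivAt (fun t : ℝ => (t * r) • u (t * m)) (r • u 0) 0 := fun {u} hu r => by
        have hu0 : HasDerivAt (fun t : ℝ => u (t * m)) (m • deriv u (0 * m)) 0 :=
          (hasDerivAt_of_contDiff hu (0 * m)).scomp 0 (hm m)
        exact ((hm r).smul hu0).congr_deriv (by simp)
      rw [hWt]
      exact (((hc hβ m).add (hc hξ1 p)).add (hc hξ q)).congr_deriv (by abel)
    rw [h2] at hz2
    obtain ⟨rfl, rfl, rfl⟩ := eq_zero_of_linearIndependent hli hz2
    rfl
  obtain ⟨e, heF, he0, hes⟩ := exists_openPartialHomeomorph_of_injective_fderiv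
    (by simp) hF hinj
  let U : Set ℝ := (fun y => ((y, 0) : ℝ × E3)) ⁻¹' e.target
  have hUo : IsOpen U := e.open_target.preimage (by fun_prop)
  have h0t : (0 : ℝ × E3) ∈ e.target := by
    have := e.map_source he0
    rwa [heF, hF0] at this
  have hU0 : (0 : ℝ) ∈ U := h0t
  let S : ℝ → ℝ × ℝ × ℝ := fun y => (e.symm (y, 0)).2
  have hSd : ContDiffOn ℝ ∞ S U :=
    contDiff_snd.comp_contDiffOn (hes.comp (by fun_prop) fun y hy => hy)
  have hS0 : S 0 = 0 := by
    have : e.symm (0 : ℝ × E3) = 0 := by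
      rw [← hF0, ← heF]
      exact e.left_inv he0
    simp only [S, ← Prod.zero_eq_mk, this]
    rfl
  have hSe : ∀ y ∈ U, e.symm (y, 0) = (y, S y) ∧ W (y, S y) = 0 := fun y hy => by
    have h1 := e.right_inv hy
    rw [heF] at h1
    have h2 : (e.symm (y, 0)).1 = y := congrArg Prod.fst h1
    have h3 : e.symm (y, 0) = (y, S y) := Prod.ext h2 rfl
    rw [h3] at h1
    exact ⟨h3, congrArg Prod.snd h1⟩
  have hUn : ∀ᶠ y in 𝓝 (0 : ℝ), y ∈ U := hUo.mem_nhds hU0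
  have hneg : Tendsto (fun y : ℝ => -y) (𝓝 0) (𝓝 0) := by
    simpa using (continuous_neg (G := ℝ)).tendsto 0
  -- `W` is even in `y`, so `S y` also solves the equation at `-y`; injectivity of `e` on its source
  -- forces equality.
  have hSeven : ∀ᶠ y in 𝓝 (0 : ℝ), S (-y) = S y := by
    have hcont : Tendsto (fun y => ((-y, S y) : ℝ × (ℝ × ℝ × ℝ))) (𝓝 0) (𝓝 0) := by
      have h1 : Tendsto S (𝓝 0) (𝓝 0) := by
        have := (hSd.continuousOn.continuousAt (hUo.mem_nhds hU0)).tendsto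
        rwa [hS0] at this
      exact hneg.prodMk_nhds h1
    filter_upwards [hUn, hneg.eventually hUn, hcont.eventually (e.open_source.mem_nhds he0)]
      with y hy hy' hsrc
    have h1 := e.left_inv hsrc
    rw [heF] at h1
    have h2 : F (-y, S y) = (-y, 0) := by
      simp only [F, hWneg, (hSe y hy).2]
    rw [h2, (hSe _ hy').1] at h1
    exact (Prod.ext_iff.1 h1).2
  obtain ⟨R, hR, hRS⟩ := exists_contDiff_eventuallyEq hUo hSd hU0
  -- Symmetrizing the global extension makes it even everywhere, without changing it near `0`.
  let T : ℝ → ℝ × ℝ × ℝ := fun y => (1 / 2 : ℝ) • (R y + R (-y))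
  have hT : ContDiff ℝ ∞ T := by fun_prop
  have hTe : ∀ y, T (-y) = T y := fun y => by simp only [T, neg_neg, add_comm]
  have hTS : ∀ᶠ y in 𝓝 (0 : ℝ), T y = S y := by
    filter_upwards [hRS, hneg.eventually hRS, hSeven] with y h1 h2 h3
    simp only [T, h1, h2, h3]
    rw [← two_smul ℝ, smul_smul]
    norm_num
  have hT0 : T 0 = 0 := hTS.self_of_nhds.trans hS0
  have hm : ContDiff ℝ ∞ fun y => (T y).1 := by fun_prop
  have hm0 : deriv (fun y => (T y).1) 0 = 0 := by
    rw [deriv_eq_smul_evenQuotient hm (fun y => by rw [hTe])]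
    simp
  refine ⟨fun y => (T y).1 + y, fun y => (T y).2.1 + y * (T y).2.2, by fun_prop, by fun_prop,
    by simp [hT0], ?_, by simp [hT0], ?_⟩
  · have := (hasDerivAt_of_contDiff hm 0).add (hasDerivAt_id 0)
    rw [hm0, zero_add] at this
    exact this.deriv
  · filter_upwards [hUn, hTS] with y hy hTy
    have hw := (hSe y hy).2
    rw [← hTy] at hw
    simp only [hTe]
    generalize T y = τ at hw
    obtain ⟨m, p, q⟩ := τ
    simp only [W] at hw
    have h1 := smul_centralMean hg.continuous hγ' m y
    have h2 := smul_centralMean hξ1.continuous (hasDerivAt_of_contDiff hξ) m y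
    have h3 := congrArg (fun x => (2 * y) • x) hw
    simp only [smul_add, smul_zero, smul_comm (2 * y) p, h1, h2] at h3
    simp only [← sub_eq_add_neg]
    rw [← sub_eq_zero, ← neg_eq_zero, ← h3]
    module

/-- A criterion for cross cap singularities of ruled surfaces. -/
theorem isCrossCapAt_ruled (hξ : ContDiff ℝ ∞ ξ) (hβ : ContDiff ℝ ∞ β) (hγ : ContDiff ℝ ∞ γ)
    (hγ0 : γ 0 = 0) (hγ' : ∀ v, HasDerivAt γ (v • β v) v)
    (hli : LinearIndependent ℝ ![ξ 0, deriv ξ 0, β 0]) :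
    IsCrossCapAt (fun p => γ p.2 + p.1 • ξ p.2) 0 := by
  obtain ⟨v, s, hv, hs, hv0, hv1, hs0, hdouble⟩ := exists_doublePointCurve hξ hβ hγ' hli
  obtain ⟨A, A₁, hA, hA₁, hK⟩ := exists_contDiff_even_odd_decomposition
    (h := fun y => γ (v y) + s y • ξ (v y)) (by fun_prop)
  obtain ⟨P, Q, hP, hQ, hX⟩ := exists_contDiff_even_odd_decomposition
    (h := fun y => ξ (v y)) (by fun_prop)
  -- By `hdouble` the function is even near `0`, so its odd part vanishes there.
  have hKA : ∀ᶠ y in 𝓝 (0 : ℝ), γ (v y) + s y • ξ (v y) = A (y ^ 2) := by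
    filter_upwards [hdouble] with y hy
    rw [hK, hK, neg_sq, neg_smul, add_right_inj, neg_eq_iff_add_eq_zero, ← two_smul ℝ] at hy
    rw [hK, (smul_eq_zero.1 hy).resolve_left two_ne_zero, add_zero]
  have hsq : ∀ y : ℝ, HasDerivAt (fun y : ℝ => y ^ 2) (2 * y) y := fun y => by
    simpa using hasDerivAt_pow 2 y
  have hvd := hasDerivAt_of_contDiff hv
  have hsd := hasDerivAt_of_contDiff hs
  have hξd := hasDerivAt_of_contDiff hξ
  have hξv : ∀ y, HasDerivAt (fun y => ξ (v y)) (deriv v y • deriv ξ (v y)) y := fun y =>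
    (hξd (v y)).scomp y (hvd y)
  have hA0 : A 0 = 0 := by
    have := hKA.self_of_nhds
    simpa [hv0, hs0, hγ0] using this.symm
  have hP0 : P 0 = ξ 0 := by
    have := hX 0
    simpa [hv0] using this.symm
  have hQ0 : Q 0 = deriv ξ 0 := by
    have h1 := hξv 0
    rw [hv0, hv1, one_smul] at h1
    have h2 : ∀ {u : ℝ → E3} (_ : ContDiff ℝ ∞ u),
        HasDerivAt (fun y : ℝ => u (y ^ 2)) 0 0 := fun {u} hu => by
      exact ((hasDerivAt_of_contDiff hu ((0 : ℝ) ^ 2)).scomp 0 (hsq 0)).congr_deriv (by simp)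
    have h3 : HasDerivAt (fun y : ℝ => P (y ^ 2) + y • Q (y ^ 2)) (Q 0) 0 := by
      exact ((h2 hP).add ((hasDerivAt_id (0 : ℝ)).smul (h2 hQ))).congr_deriv (by simp)
    rw [funext hX] at h1
    exact h3.unique h1
  -- Both sides are the second derivative at `0` of `γ(v(y)) + s(y) ξ(v(y)) = A(y²)`. The term `β 0`
  -- is what makes `A'(0)`, `P(0)`, `Q(0)` independent.
  have hA1 : (2 : ℝ) • deriv A 0 =
      β 0 + deriv (deriv s) 0 • ξ 0 + (2 * deriv s 0) • deriv ξ 0 := by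
    have hA' : HasDerivAt (fun y : ℝ => (2 * y) • deriv A (y ^ 2)) ((2 : ℝ) • deriv A 0) 0 := by
      have h1 := (hasDerivAt_of_contDiff (contDiff_deriv hA) ((0 : ℝ) ^ 2)).scomp 0 (hsq 0)
      have h2 : HasDerivAt (fun y : ℝ => 2 * y) 2 0 := by
        simpa using (hasDerivAt_id (0 : ℝ)).const_mul 2
      exact (h2.smul h1).congr_deriv (by simp)
    have hev : (fun y : ℝ => (2 * y) • deriv A (y ^ 2)) =ᶠ[𝓝 0] fun y =>
        deriv v y • v y • β (v y) + (s y • deriv v y • deriv ξ (v y) + deriv s y • ξ (v y)) := by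
      filter_upwards [hKA.eventually_nhds] with y hy
      have h1 : HasDerivAt (fun y : ℝ => A (y ^ 2)) ((2 * y) • deriv A (y ^ 2)) y :=
        (hasDerivAt_of_contDiff hA (y ^ 2)).scomp y (hsq y)
      have h2 : HasDerivAt (fun y => γ (v y) + s y • ξ (v y))
          (deriv v y • v y • β (v y) +
            (s y • deriv v y • deriv ξ (v y) + deriv s y • ξ (v y))) y :=
        ((hγ' (v y)).scomp y (hvd y)).add ((hsd y).smul (hξv y))
      exact h1.unique (h2.congr_of_eventuallyEq (EventuallyEq.symm hy))
    have hβv : HasDerivAt (fun y => β (v y)) (deriv v 0 • deriv β (v 0)) 0 :=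
      (hasDerivAt_of_contDiff hβ (v 0)).scomp 0 (hvd 0)
    have hξ'v : HasDerivAt (fun y => deriv ξ (v y)) (deriv v 0 • deriv (deriv ξ) (v 0)) 0 :=
      (hasDerivAt_of_contDiff (contDiff_deriv hξ) (v 0)).scomp 0 (hvd 0)
    have hv'd := hasDerivAt_of_contDiff (contDiff_deriv hv) 0
    have hs'd := hasDerivAt_of_contDiff (contDiff_deriv hs) 0
    have hR := (hv'd.smul ((hvd 0).smul hβv)).add
      (((hsd 0).smul (hv'd.smul hξ'v)).add (hs'd.smul (hξv 0)))
    rw [(hA'.congr_of_eventuallyEq hev.symm).unique hR]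
    simp only [Pi.smul_apply', hv0, hv1, hs0]
    module
  let Ψ : E3 → E3 := fun z => A (z 2) + z 0 • P (z 2) + z 1 • Q (z 2)
  have hΨ : ContDiff ℝ ∞ Ψ := by fun_prop
  have hΨinj : ∀ z, fderiv ℝ Ψ 0 z = 0 → z = 0 := fun z hz => by
    have hm : ∀ r : ℝ, HasDerivAt (fun t : ℝ => t * r) r 0 := fun r => by
      simpa using (hasDerivAt_id (0 : ℝ)).mul_const r
    have hu0 : ∀ {u : ℝ → E3} (_ : ContDiff ℝ ∞ u) (m : ℝ),
        HasDerivAt (fun t : ℝ => u (t * m)) (m • deriv u 0) 0 := fun {u} hu m => by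
      have := (hasDerivAt_of_contDiff hu (0 * m)).scomp 0 (hm m)
      rwa [zero_mul] at this
    have hc : ∀ {u : ℝ → E3} (_ : ContDiff ℝ ∞ u) (m r : ℝ),
        HasDerivAt (fun t : ℝ => (t * r) • u (t * m)) (r • u 0) 0 := fun {u} hu m r => by
      exact ((hm r).smul (hu0 hu m)).congr_deriv (by simp)
    have h1 : fderiv ℝ Ψ 0 z = z 2 • deriv A 0 + z 0 • P 0 + z 1 • Q 0 :=
      fderiv_apply_eq_of_hasDerivAt hΨ
        (((hu0 hA (z 2)).add (hc hP (z 2) (z 0))).add (hc hQ (z 2) (z 1)))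
    rw [h1, hP0, hQ0] at hz
    have h2 : (2 * z 0 + z 2 * deriv (deriv s) 0) • ξ 0 +
        (2 * z 1 + z 2 * (2 * deriv s 0)) • deriv ξ 0 + z 2 • β 0 = 0 := by
      have h3 := congrArg (fun x => (2 : ℝ) • x) hz
      simp only [smul_add, smul_zero, smul_comm (2 : ℝ) (z 2), hA1] at h3
      rw [← h3]
      module
    obtain ⟨h3, h4, h5⟩ := eq_zero_of_linearIndependent hli h2
    rw [h5] at h3 h4
    ext i
    fin_cases i
    · simpa using h3
    · simpa using h4
    · simpa using h5
  obtain ⟨eΨ, heΨ, heΨ0, heΨs⟩ := exists_openPartialHomeomorph_of_injective_fderiv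
    rfl hΨ hΨinj
  -- In these coordinates the double point curve is the axis `x = 0`.
  let κ : ℝ × ℝ → ℝ × ℝ := fun p => (s p.2 + p.1, v p.2)
  have hκ : ContDiff ℝ ∞ κ := by fun_prop
  have hκinj : ∀ z, fderiv ℝ κ 0 z = 0 → z = 0 := fun z hz => by
    have hm : ∀ r : ℝ, HasDerivAt (fun t : ℝ => t * r) r 0 := fun r => by
      simpa using (hasDerivAt_id (0 : ℝ)).mul_const r
    have hu0 : ∀ {u : ℝ → ℝ} (_ : ContDiff ℝ ∞ u) (m : ℝ),
        HasDerivAt (fun t : ℝ => u (t * m)) (m • deriv u 0) 0 := fun {u} hu m => by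
      have := (hasDerivAt_of_contDiff hu (0 * m)).scomp 0 (hm m)
      rwa [zero_mul] at this
    have h1 : fderiv ℝ κ 0 z = (z.2 • deriv s 0 + z.1, z.2 • deriv v 0) :=
      fderiv_apply_eq_of_hasDerivAt hκ
        (((hu0 hs z.2).add (hm z.1)).prodMk (hu0 hv z.2))
    rw [h1, hv1] at hz
    have h2 : z.2 = 0 := by simpa using congrArg Prod.snd hz
    have h3 : z.1 = 0 := by simpa [h2] using congrArg Prod.fst hz
    exact Prod.ext h3 h2
  obtain ⟨eκ, heκ, heκ0, heκs⟩ := exists_openPartialHomeomorph_of_injective_fderiv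
    rfl hκ hκinj
  obtain ⟨O, hO, hOo, hO0⟩ := eventually_nhds_iff.1 hKA
  have hfStd : Continuous fStd := by unfold fStd; fun_prop
  let V : Set (ℝ × ℝ) := Prod.snd ⁻¹' O ∩ fStd ⁻¹' eΨ.source
  have hV : IsOpen V := (hOo.preimage continuous_snd).inter (eΨ.open_source.preimage hfStd)
  have hstd0 : fStd 0 = 0 := by
    ext i
    fin_cases i <;> simp [fStd]
  have hV0 : (0 : ℝ × ℝ) ∈ V := ⟨hO0, by
    rw [Set.mem_preimage, hstd0]
    exact heΨ0⟩
  let e := eκ.restrOpen V hV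
  have heκ' : ∀ p, e p = κ p := heκ
  have he0 : (0 : ℝ × ℝ) ∈ e.source := ⟨heκ0, hV0⟩
  have hκ0 : κ 0 = 0 := by simp [κ, hv0, hs0]
  have hΨ0 : Ψ 0 = 0 := by simp [Ψ, hA0]
  have hf : ∀ p ∈ V, γ (κ p).2 + (κ p).1 • ξ (κ p).2 = Ψ (fStd p) := fun p hp => by
    have h1 := hO p.2 hp.1
    have h2 := hX p.2
    simp only [κ, Ψ, fStd, add_smul, ← add_assoc]
    rw [h1, h2]
    simp only [Matrix.cons_val]
    module
  have hp : ∀ q ∈ e.target, e.symm q ∈ V ∧ κ (e.symm q) = q := fun q hq =>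
    ⟨(e.map_target hq).2, by rw [← heκ']; exact e.right_inv hq⟩
  have hf' : ∀ q ∈ e.target, γ q.2 + q.1 • ξ q.2 = eΨ (fStd (e.symm q)) := fun q hq => by
    rw [heΨ, ← hf _ (hp q hq).1, (hp q hq).2]
  have h0 : γ (0 : ℝ × ℝ).2 + (0 : ℝ × ℝ).1 • ξ (0 : ℝ × ℝ).2 = eΨ 0 := by
    rw [heΨ, hΨ0]
    simp [hγ0]
  have he00 : e 0 = 0 := (heκ' 0).trans hκ0
  -- `κ` and `Ψ` lead from the standard cross cap to the surface, so the required diffeomorphisms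
  -- are their inverses.
  refine ⟨e.symm, eΨ.symm, heκs.mono fun q hq => ?_, ?_, heΨs, ?_, ?_, ?_, ?_, ?_, ?_, ?_⟩
  · exact hq.1
  · exact hκ.contDiffOn.congr fun p _ => heκ' p
  · exact hΨ.contDiffOn.congr fun p _ => heΨ p
  · have := e.map_source he0
    rwa [he00] at this
  · have := e.left_inv he0
    rwa [he00] at this
  · simp only [h0]
    exact eΨ.map_source heΨ0
  · simp only [h0]
    exact eΨ.left_inv heΨ0
  · intro q hq
    have := eΨ.map_source (hp q hq).1.2
    rwa [← hf' q hq] at this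
  · intro q hq
    simp only [hf' q hq]
    exact eΨ.left_inv (hp q hq).1.2

end Ruled

/-! ### Vector product identities -/

theorem inner_eq_sum (x y : E3) : inner ℝ x y = x 0 * y 0 + x 1 * y 1 + x 2 * y 2 := by
  simp only [PiLp.inner_apply, Fin.sum_univ_three, RCLike.inner_apply, conj_trivial]
  ring

theorem cross_eq (x y : E3) :
    cross x y = !₂[x 1 * y 2 - x 2 * y 1, x 2 * y 0 - x 0 * y 2, x 0 * y 1 - x 1 * y 0] := by
  rw [cross, cross_apply]

theorem inner_left_cross (x y : E3) : inner ℝ x (cross x y) = 0 := by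
  rw [inner_eq_sum, cross_eq]
  simp
  ring

theorem inner_right_cross (x y : E3) : inner ℝ y (cross x y) = 0 := by
  rw [inner_eq_sum, cross_eq]
  simp
  ring

theorem inner_cross_cross (x y : E3) : inner ℝ (cross x y) (cross x y) =
    inner ℝ x x * inner ℝ y y - inner ℝ x y ^ 2 := by
  simp only [inner_eq_sum, cross_eq]
  simp
  ring

theorem det_eq_inner_cross (x y z : E3) :
    (EuclideanSpace.basisFun (Fin 3) ℝ).toBasis.det ![x, y, z] = inner ℝ z (cross x y) := by
  rw [inner_eq_sum, cross_eq, Module.Basis.det_apply, Matrix.det_fin_three]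
  simp [Module.Basis.toMatrix_apply]
  ring

/-- Pair with `A z`: the triple product of `A x`, `A y`, `A z` is `det A` times that of `x`, `y`,
`z`, and `A` preserves inner products. -/
theorem cross_map (A : E3 ≃ₗᵢ[ℝ] E3) (x y : E3) : cross (A x) (A y) =
    LinearMap.det (A.toLinearEquiv : E3 →ₗ[ℝ] E3) • A (cross x y) := by
  refine ext_inner_left ℝ fun w => ?_
  obtain ⟨z, rfl⟩ := A.surjective w
  rw [inner_smul_right, A.inner_map_map, ← det_eq_inner_cross, ← det_eq_inner_cross,
    ← Module.Basis.det_comp]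
  congr 1
  funext i
  fin_cases i <;> rfl

theorem contDiff_cross {X : Type*} [NormedAddCommGroup X] [NormedSpace ℝ X] {f g : X → E3}
    (hf : ContDiff ℝ ∞ f) (hg : ContDiff ℝ ∞ g) : ContDiff ℝ ∞ fun x => cross (f x) (g x) := by
  rw [contDiff_euclidean]
  intro i
  simp only [cross_eq]
  fin_cases i <;> simp <;> fun_prop

/-! ### The surfaces `f_c` and their first fundamental form -/

section SphericalCurve

variable {a₁₁ a₀₂ : ℝ} {c : ℝ → E3}

theorem arctan_mem_arcInterval (x : ℝ) : Real.arctan x ∈ arcInterval := Real.arctan_mem_Ioo x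

theorem isOpen_arcInterval : IsOpen arcInterval := isOpen_Ioo

theorem IsSphericalCurve.hasDerivAt (hc : IsSphericalCurve c) {s : ℝ} (hs : s ∈ arcInterval) :
    HasDerivAt c (deriv c s) s :=
  ((hc.smooth.contDiffAt (isOpen_arcInterval.mem_nhds hs)).differentiableAt
    (by simp)).hasDerivAt

theorem IsSphericalCurve.inner_self (hc : IsSphericalCurve c) {s : ℝ} (hs : s ∈ arcInterval) :
    inner ℝ (c s) (c s) = 1 := by
  have := hc.mem_sphere s hs
  rw [mem_sphere_zero_iff_norm] at this
  rw [real_inner_self_eq_norm_sq, this, one_pow]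

theorem IsSphericalCurve.inner_deriv_deriv (hc : IsSphericalCurve c) {s : ℝ}
    (hs : s ∈ arcInterval) : inner ℝ (deriv c s) (deriv c s) = 1 := by
  rw [real_inner_self_eq_norm_sq, hc.unit_speed s hs, one_pow]

theorem IsSphericalCurve.inner_deriv (hc : IsSphericalCurve c) {s : ℝ} (hs : s ∈ arcInterval) :
    inner ℝ (c s) (deriv c s) = 0 := by
  have h1 := (hc.hasDerivAt hs).inner ℝ (hc.hasDerivAt hs)
  have h2 : (fun t => inner ℝ (c t) (c t)) =ᶠ[𝓝 s] fun _ => (1 : ℝ) := by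
    filter_upwards [isOpen_arcInterval.mem_nhds hs] with t ht
    exact hc.inner_self ht
  have h3 := h1.unique ((hasDerivAt_const s (1 : ℝ)).congr_of_eventuallyEq h2)
  rw [real_inner_comm (c s)] at h3
  linarith

theorem one_add_mul_sq_pos (a v : ℝ) : 0 < 1 + (1 + a ^ 2) * v ^ 2 := by positivity

theorem contDiff_cHat (hc : IsSphericalCurve c) : ContDiff ℝ ∞ (cHat a₁₁ c) := by
  have h : ContDiff ℝ ∞ fun v : ℝ => Real.arctan (v * √(1 + a₁₁ ^ 2)) :=
    Real.contDiff_arctan.comp (by fun_prop)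
  rw [← contDiffOn_univ] at h ⊢
  exact hc.smooth.comp h fun v _ => arctan_mem_arcInterval _

theorem contDiff_sqrt_one_add (a : ℝ) :
    ContDiff ℝ ∞ fun v : ℝ => √(1 + (1 + a ^ 2) * v ^ 2) :=
  ContDiff.sqrt (by fun_prop) fun v => (one_add_mul_sq_pos a v).ne'

theorem contDiff_xi (hc : IsSphericalCurve c) : ContDiff ℝ ∞ (xi a₁₁ c) :=
  (contDiff_sqrt_one_add a₁₁).smul (contDiff_cHat hc)

/-- With `r = √(1 + (1 + a₁₁²) v²)`, the arctangent contributes `√(1 + a₁₁²) / r²` and the scaling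
of `ξ` a factor `r`. The result is expressed in the orthonormal pair `c'`, `c`. -/
theorem hasDerivAt_xi (hc : IsSphericalCurve c) (v : ℝ) : HasDerivAt (xi a₁₁ c)
    ((√(1 + a₁₁ ^ 2) / √(1 + (1 + a₁₁ ^ 2) * v ^ 2)) •
      deriv c (Real.arctan (v * √(1 + a₁₁ ^ 2))) +
      ((1 + a₁₁ ^ 2) * v / √(1 + (1 + a₁₁ ^ 2) * v ^ 2)) • cHat a₁₁ c v) v := by
  have hpos := one_add_mul_sq_pos a₁₁ v
  have hk : √(1 + a₁₁ ^ 2) ^ 2 = 1 + a₁₁ ^ 2 := Real.sq_sqrt (by positivity)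
  have hr : √(1 + (1 + a₁₁ ^ 2) * v ^ 2) ^ 2 = 1 + (1 + a₁₁ ^ 2) * v ^ 2 := Real.sq_sqrt hpos.le
  have hr0 : √(1 + (1 + a₁₁ ^ 2) * v ^ 2) ≠ 0 := (Real.sqrt_pos.2 hpos).ne'
  have h1 : HasDerivAt (fun v : ℝ => v * √(1 + a₁₁ ^ 2)) √(1 + a₁₁ ^ 2) v := by
    simpa using (hasDerivAt_id v).mul_const √(1 + a₁₁ ^ 2)
  have h2 := (hc.hasDerivAt (arctan_mem_arcInterval (v * √(1 + a₁₁ ^ 2)))).scomp v h1.arctan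
  have h3 : HasDerivAt (fun v : ℝ => 1 + (1 + a₁₁ ^ 2) * v ^ 2) ((1 + a₁₁ ^ 2) * (2 * v)) v := by
    simpa using ((hasDerivAt_pow 2 v).const_mul (1 + a₁₁ ^ 2)).const_add 1
  refine ((h3.sqrt hpos.ne').smul h2).congr_deriv ?_
  rw [smul_smul, Function.comp_apply, mul_pow, hk]
  congr 2
  · rw [show 1 + v ^ 2 * (1 + a₁₁ ^ 2) = √(1 + (1 + a₁₁ ^ 2) * v ^ 2) ^ 2 by rw [hr]; ring]
    field_simp
  · field_simp

theorem inner_xi_xi (hc : IsSphericalCurve c) (v : ℝ) :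
    inner ℝ (xi a₁₁ c v) (xi a₁₁ c v) = 1 + (1 + a₁₁ ^ 2) * v ^ 2 := by
  rw [xi, real_inner_smul_left, real_inner_smul_right, cHat,
    hc.inner_self (arctan_mem_arcInterval _), mul_one,
    Real.mul_self_sqrt (one_add_mul_sq_pos a₁₁ v).le]

theorem inner_xi_deriv (hc : IsSphericalCurve c) (v : ℝ) :
    inner ℝ (xi a₁₁ c v) (deriv (xi a₁₁ c) v) = (1 + a₁₁ ^ 2) * v := by
  have hr0 := (Real.sqrt_pos.2 (one_add_mul_sq_pos a₁₁ v)).ne'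
  rw [(hasDerivAt_xi hc v).deriv, xi, inner_add_right]
  simp only [real_inner_smul_left, real_inner_smul_right, cHat,
    hc.inner_self (arctan_mem_arcInterval _), hc.inner_deriv (arctan_mem_arcInterval _)]
  field_simp
  ring

theorem inner_deriv_xi_deriv_xi (hc : IsSphericalCurve c) (v : ℝ) :
    inner ℝ (deriv (xi a₁₁ c) v) (deriv (xi a₁₁ c) v) = 1 + a₁₁ ^ 2 := by
  have hpos := one_add_mul_sq_pos a₁₁ v
  have hr0 := (Real.sqrt_pos.2 hpos).ne'
  have hk : √(1 + a₁₁ ^ 2) ^ 2 = 1 + a₁₁ ^ 2 := Real.sq_sqrt (by positivity)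
  have hr : √(1 + (1 + a₁₁ ^ 2) * v ^ 2) ^ 2 = 1 + (1 + a₁₁ ^ 2) * v ^ 2 := Real.sq_sqrt hpos.le
  rw [(hasDerivAt_xi hc v).deriv]
  simp only [inner_add_right, inner_add_left, real_inner_smul_left, real_inner_smul_right, cHat,
    hc.inner_self (arctan_mem_arcInterval _), hc.inner_deriv (arctan_mem_arcInterval _),
    hc.inner_deriv_deriv (arctan_mem_arcInterval _), real_inner_comm (c _) (deriv c _)]
  field_simp
  rw [hr]
  linear_combination hk

theorem contDiff_B (hc : IsSphericalCurve c) : ContDiff ℝ ∞ (B a₁₁ c) :=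
  ((contDiff_deriv (contDiff_xi hc)).const_smul a₁₁).add
    (contDiff_cross (contDiff_xi hc) (contDiff_deriv (contDiff_xi hc)))

/-- In Lagrange's identity the terms in `v²` cancel. -/
theorem inner_cross_xi (hc : IsSphericalCurve c) (v : ℝ) :
    inner ℝ (cross (xi a₁₁ c v) (deriv (xi a₁₁ c) v)) (cross (xi a₁₁ c v) (deriv (xi a₁₁ c) v)) =
      1 + a₁₁ ^ 2 := by
  rw [inner_cross_cross, inner_xi_xi hc, inner_xi_deriv hc, inner_deriv_xi_deriv_xi hc]
  ring

theorem inner_xi_B (hc : IsSphericalCurve c) (v : ℝ) :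
    inner ℝ (xi a₁₁ c v) (B a₁₁ c v) = a₁₁ * ((1 + a₁₁ ^ 2) * v) := by
  rw [B, inner_add_right, real_inner_smul_right, inner_xi_deriv hc, inner_left_cross, add_zero]

theorem inner_deriv_xi_B (hc : IsSphericalCurve c) (v : ℝ) :
    inner ℝ (deriv (xi a₁₁ c) v) (B a₁₁ c v) = a₁₁ * (1 + a₁₁ ^ 2) := by
  rw [B, inner_add_right, real_inner_smul_right, inner_deriv_xi_deriv_xi hc, inner_right_cross,
    add_zero]

theorem inner_B_B (hc : IsSphericalCurve c) (v : ℝ) :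
    inner ℝ (B a₁₁ c v) (B a₁₁ c v) = (1 + a₁₁ ^ 2) ^ 2 := by
  have h := inner_deriv_xi_B (a₁₁ := a₁₁) hc v
  nth_rw 1 [B]
  rw [inner_add_left, real_inner_smul_left, h, B, inner_add_right, real_inner_smul_right,
    real_inner_comm, inner_right_cross, inner_cross_xi hc]
  ring

theorem hasDerivAt_gam (hc : IsSphericalCurve c) (v : ℝ) :
    HasDerivAt (gam a₁₁ a₀₂ c) (v • (a₀₂ / (1 + a₁₁ ^ 2)) • B a₁₁ c v) v := by
  have h : Continuous fun t => t • B a₁₁ c t := continuous_id.smul (contDiff_B hc).continuous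
  rw [smul_comm]
  exact (intervalIntegral.integral_hasDerivAt_right (h.intervalIntegrable _ _)
    (h.stronglyMeasurableAtFilter _ _) h.continuousAt).const_smul (a₀₂ / (1 + a₁₁ ^ 2))

theorem contDiff_gam (hc : IsSphericalCurve c) : ContDiff ℝ ∞ (gam a₁₁ a₀₂ c) := by
  rw [contDiff_infty_iff_deriv]
  refine ⟨fun v => (hasDerivAt_gam hc v).differentiableAt, ?_⟩
  have h : deriv (gam a₁₁ a₀₂ c) = fun v => v • (a₀₂ / (1 + a₁₁ ^ 2)) • B a₁₁ c v :=
    funext fun v => (hasDerivAt_gam hc v).deriv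
  rw [h]
  exact contDiff_id.smul ((contDiff_B hc).const_smul _)

theorem gam_zero : gam a₁₁ a₀₂ c 0 = 0 := by simp [gam]

theorem ruled_zero : ruled a₁₁ a₀₂ c 0 = 0 := by simp [ruled, gam_zero]

theorem contDiff_ruled (hc : IsSphericalCurve c) : ContDiff ℝ ∞ (ruled a₁₁ a₀₂ c) := by
  have h1 := contDiff_gam (a₁₁ := a₁₁) (a₀₂ := a₀₂) hc
  have h2 := contDiff_xi (a₁₁ := a₁₁) hc
  unfold ruled
  fun_prop

/-- At `v = 0` the vectors `ξ`, `ξ'`, `ξ × ξ'` are nonzero and mutually orthogonal, and `B` has a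
nonzero component along the third. -/
theorem linearIndependent_xi (ha₀₂ : 0 < a₀₂) (hc : IsSphericalCurve c) :
    LinearIndependent ℝ ![xi a₁₁ c 0, deriv (xi a₁₁ c) 0,
      (a₀₂ / (1 + a₁₁ ^ 2)) • B a₁₁ c 0] := by
  have hk : 0 < 1 + a₁₁ ^ 2 := by positivity
  have h1 := inner_xi_xi (a₁₁ := a₁₁) hc 0
  have h2 := inner_xi_deriv (a₁₁ := a₁₁) hc 0
  have h3 := inner_deriv_xi_deriv_xi (a₁₁ := a₁₁) hc 0
  have h4 := inner_cross_xi (a₁₁ := a₁₁) hc 0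
  unfold B
  generalize xi a₁₁ c 0 = x at *
  generalize deriv (xi a₁₁ c) 0 = y at *
  have h5 : inner ℝ y x = 0 := by rw [real_inner_comm, h2, mul_zero]
  rw [Fintype.linearIndependent_iff]
  intro g hg
  rw [Fin.sum_univ_three] at hg
  simp only [Matrix.cons_val] at hg
  have e1 := congrArg (inner ℝ (cross x y)) hg
  have e2 := congrArg (inner ℝ x) hg
  have e3 := congrArg (inner ℝ y) hg
  simp only [inner_add_right, real_inner_smul_right, inner_zero_right, h1, h2, h3, h4, h5,
    inner_left_cross, inner_right_cross, real_inner_comm x (cross x y),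
    real_inner_comm y (cross x y)] at e1 e2 e3
  have hg2 : g 2 = 0 := by
    have : g 2 * a₀₂ = 0 := by
      field_simp at e1
      exact (mul_eq_zero.1 (by linarith : g 2 * a₀₂ * (1 + a₁₁ ^ 2) = 0)).resolve_right hk.ne'
    exact (mul_eq_zero.1 this).resolve_right ha₀₂.ne'
  rw [hg2] at e2 e3
  have hg0 : g 0 = 0 := by linarith
  have hg1 : g 1 = 0 := by
    have : g 1 * (1 + a₁₁ ^ 2) = 0 := by linarith
    exact (mul_eq_zero.1 this).resolve_right hk.ne'
  intro i
  fin_cases i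
  exacts [hg0, hg1, hg2]

theorem isCrossCapAt_ruled_zero (ha₀₂ : 0 < a₀₂) (hc : IsSphericalCurve c) :
    IsCrossCapAt (ruled a₁₁ a₀₂ c) 0 :=
  isCrossCapAt_ruled (contDiff_xi hc) ((contDiff_B hc).const_smul _) (contDiff_gam hc) gam_zero
    (hasDerivAt_gam hc) (linearIndependent_xi ha₀₂ hc)

theorem hasFDerivAt_ruled (hc : IsSphericalCurve c) (p : ℝ × ℝ) :
    HasFDerivAt (ruled a₁₁ a₀₂ c)
      ((ContinuousLinearMap.snd ℝ ℝ ℝ).smulRight (p.2 • (a₀₂ / (1 + a₁₁ ^ 2)) • B a₁₁ c p.2) +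
        (p.1 • (ContinuousLinearMap.snd ℝ ℝ ℝ).smulRight (deriv (xi a₁₁ c) p.2) +
          (ContinuousLinearMap.fst ℝ ℝ ℝ).smulRight (xi a₁₁ c p.2))) p := by
  have h1 := (hasDerivAt_gam (a₁₁ := a₁₁) (a₀₂ := a₀₂) hc p.2).hasFDerivAt.comp p
    (hasFDerivAt_snd (𝕜 := ℝ) (p := p))
  have h2 := (hasDerivAt_of_contDiff (contDiff_xi (a₁₁ := a₁₁) hc) p.2).hasFDerivAt.comp p
    (hasFDerivAt_snd (𝕜 := ℝ) (p := p))
  exact h1.add ((hasFDerivAt_fst (𝕜 := ℝ) (p := p)).smul h2)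

theorem partialU_ruled (hc : IsSphericalCurve c) (p : ℝ × ℝ) :
    partialU (ruled a₁₁ a₀₂ c) p = xi a₁₁ c p.2 := by
  rw [partialU, (hasFDerivAt_ruled hc p).fderiv]
  simp

theorem partialV_ruled (hc : IsSphericalCurve c) (p : ℝ × ℝ) :
    partialV (ruled a₁₁ a₀₂ c) p =
      p.2 • (a₀₂ / (1 + a₁₁ ^ 2)) • B a₁₁ c p.2 + p.1 • deriv (xi a₁₁ c) p.2 := by
  rw [partialV, (hasFDerivAt_ruled hc p).fderiv]
  simp

/-- All surfaces `f_c` have the same first fundamental form. -/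
theorem isIsometric_ruled (ha₀₂ : 0 < a₀₂) {c₁ c₂ : ℝ → E3} (hc₁ : IsSphericalCurve c₁)
    (hc₂ : IsSphericalCurve c₂) : IsIsometric (ruled a₁₁ a₀₂ c₁) (ruled a₁₁ a₀₂ c₂) where
  smooth_left := contDiff_ruled hc₁
  smooth_right := contDiff_ruled hc₂
  crossCap_left := isCrossCapAt_ruled_zero ha₀₂ hc₁
  crossCap_right := isCrossCapAt_ruled_zero ha₀₂ hc₂
  uu p := by
    rw [partialU_ruled hc₁, partialU_ruled hc₂, inner_xi_xi hc₁, inner_xi_xi hc₂]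
  uv p := by
    simp only [partialU_ruled hc₁, partialU_ruled hc₂, partialV_ruled hc₁, partialV_ruled hc₂,
      inner_add_right, real_inner_smul_right, inner_xi_deriv hc₁, inner_xi_deriv hc₂,
      inner_xi_B hc₁, inner_xi_B hc₂]
  vv p := by
    simp only [partialV_ruled hc₁, partialV_ruled hc₂, inner_add_right, inner_add_left,
      real_inner_smul_right, real_inner_smul_left, inner_deriv_xi_deriv_xi hc₁,
      inner_deriv_xi_deriv_xi hc₂, inner_B_B hc₁, inner_B_B hc₂, inner_deriv_xi_B hc₁,
      inner_deriv_xi_B hc₂, real_inner_comm (deriv _ _) (B _ _ _)]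

end SphericalCurve

/-! ### Congruence of surfaces and of curves -/

section Congruence

variable {a₁₁ a₀₂ : ℝ} {c c₁ c₂ : ℝ → E3}

theorem hasDerivAt_map (A : E3 ≃ₗᵢ[ℝ] E3) {f : ℝ → E3} {f' : E3} {x : ℝ}
    (hf : HasDerivAt f f' x) : HasDerivAt (fun x => A (f x)) (A f') x :=
  A.toContinuousLinearEquiv.toContinuousLinearMap.hasFDerivAt.comp_hasDerivAt x hf

theorem deriv_xi_map (hc₁ : IsSphericalCurve c₁) {A : E3 ≃ₗᵢ[ℝ] E3}
    (h : ∀ v, xi a₁₁ c₂ v = A (xi a₁₁ c₁ v)) (v : ℝ) :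
    deriv (xi a₁₁ c₂) v = A (deriv (xi a₁₁ c₁) v) := by
  rw [funext h]
  exact (hasDerivAt_map A (hasDerivAt_of_contDiff (contDiff_xi hc₁) v)).deriv

theorem ruled_eq_map (hc₁ : IsSphericalCurve c₁) {A : E3 ≃ₗᵢ[ℝ] E3}
    (hA : LinearMap.det (A.toLinearEquiv : E3 →ₗ[ℝ] E3) = 1)
    (h : ∀ s ∈ arcInterval, c₂ s = A (c₁ s)) (p : ℝ × ℝ) :
    ruled a₁₁ a₀₂ c₂ p = A (ruled a₁₁ a₀₂ c₁ p) := by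
  have hxi : ∀ v, xi a₁₁ c₂ v = A (xi a₁₁ c₁ v) := fun v => by
    rw [xi, xi, map_smul, cHat, cHat, h _ (arctan_mem_arcInterval _)]
  have hB : ∀ v, B a₁₁ c₂ v = A (B a₁₁ c₁ v) := fun v => by
    rw [B, B, deriv_xi_map hc₁ hxi, hxi, cross_map, hA, one_smul, map_add, map_smul]
  have hc : Continuous fun t => t • B a₁₁ c₁ t := continuous_id.smul (contDiff_B hc₁).continuous
  have hint : ∫ t in (0 : ℝ)..p.2, t • B a₁₁ c₂ t = A (∫ t in (0 : ℝ)..p.2, t • B a₁₁ c₁ t) := by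
    have := A.toContinuousLinearEquiv.toContinuousLinearMap.intervalIntegral_comp_comm
      (hc.intervalIntegrable (μ := volume) 0 p.2)
    simp only [hB, ← map_smul]
    exact this
  rw [ruled, ruled, gam, gam, hint, hxi, map_add, map_smul, map_smul]

theorem xi_eq_of_ruled_eq {A : E3 ≃ₗᵢ[ℝ] E3}
    (h : ∀ p, ruled a₁₁ a₀₂ c₂ p = A (ruled a₁₁ a₀₂ c₁ p)) (v : ℝ) :
    xi a₁₁ c₂ v = A (xi a₁₁ c₁ v) := by
  have h0 := h (0, v)
  have h1 := h (1, v)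
  simp only [ruled, zero_smul, add_zero, one_smul, map_add] at h0 h1
  rwa [h0, add_right_inj] at h1

theorem curve_eq_of_ruled_eq {A : E3 ≃ₗᵢ[ℝ] E3}
    (h : ∀ p, ruled a₁₁ a₀₂ c₂ p = A (ruled a₁₁ a₀₂ c₁ p)) {s : ℝ} (hs : s ∈ arcInterval) :
    c₂ s = A (c₁ s) := by
  have hk : 0 < √(1 + a₁₁ ^ 2) := Real.sqrt_pos.2 (by positivity)
  -- This value of `v` makes the arctangent in `cHat` equal to `s`.
  have h1 := xi_eq_of_ruled_eq h (Real.tan s / √(1 + a₁₁ ^ 2))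
  have hr := (Real.sqrt_pos.2 (one_add_mul_sq_pos a₁₁ (Real.tan s / √(1 + a₁₁ ^ 2)))).ne'
  rw [xi, xi, map_smul, cHat, cHat, div_mul_cancel₀ _ hk.ne', Real.arctan_tan hs.1 hs.2] at h1
  exact smul_right_injective _ hr h1

/-- `A` carries `B₁` to `B₂` and `ξ₁'` to `ξ₂'`, hence `ξ₁ × ξ₁'` to `ξ₂ × ξ₂'`; by `cross_map` a
reflection would reverse the sign of this nonzero vector. -/
theorem det_eq_one_of_ruled_eq (ha₀₂ : 0 < a₀₂) (hc₁ : IsSphericalCurve c₁)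
    (hc₂ : IsSphericalCurve c₂) {A : E3 ≃ₗᵢ[ℝ] E3}
    (h : ∀ p, ruled a₁₁ a₀₂ c₂ p = A (ruled a₁₁ a₀₂ c₁ p)) :
    LinearMap.det (A.toLinearEquiv : E3 →ₗ[ℝ] E3) = 1 := by
  have hk : (0 : ℝ) < 1 + a₁₁ ^ 2 := by positivity
  have hgam : gam a₁₁ a₀₂ c₂ = fun v => A (gam a₁₁ a₀₂ c₁ v) := funext fun v => by
    simpa [ruled] using h (0, v)
  -- Any `v ≠ 0` would do; at `v = 0` the factor `v` in `γ'` hides `B`.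
  have hd := hasDerivAt_gam (a₁₁ := a₁₁) (a₀₂ := a₀₂) hc₂ 1
  rw [hgam] at hd
  have hB := hd.unique (hasDerivAt_map A (hasDerivAt_gam (a₁₁ := a₁₁) (a₀₂ := a₀₂) hc₁ 1))
  rw [one_smul, one_smul, map_smul] at hB
  replace hB := smul_right_injective _ (div_pos ha₀₂ hk).ne' hB
  have hx := xi_eq_of_ruled_eq h
  have hx' := deriv_xi_map hc₁ hx
  simp only [B, map_add, map_smul, ← hx', add_right_inj] at hB
  have hcr := cross_map A (xi a₁₁ c₁ 1) (deriv (xi a₁₁ c₁) 1)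
  rw [← hB, ← hx, ← hx'] at hcr
  have hi := inner_cross_xi (a₁₁ := a₁₁) hc₂ 1
  have h2 := congrArg (inner ℝ (cross (xi a₁₁ c₂ 1) (deriv (xi a₁₁ c₂) 1))) hcr
  rw [real_inner_smul_right, hi] at h2
  exact (mul_right_cancel₀ hk.ne' ((one_mul _).trans h2)).symm

theorem congruent_ruled_iff (hc₁ : IsSphericalCurve c₁) :
    Congruent (ruled a₁₁ a₀₂ c₁) (ruled a₁₁ a₀₂ c₂) ↔ CurveCongruent c₁ c₂ := by
  constructor
  · rintro ⟨A, b, hA, h⟩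
    have hb : b = 0 := by simpa [ruled_zero] using (h 0).symm
    subst hb
    simp only [add_zero] at h
    exact ⟨A, hA, fun s hs => curve_eq_of_ruled_eq h hs⟩
  · rintro ⟨A, hA, h⟩
    exact ⟨A, 0, hA, fun p => by rw [add_zero, ruled_eq_map hc₁ hA h]⟩

theorem congruent_of_isometryEquiv (ha₀₂ : 0 < a₀₂) (hc₁ : IsSphericalCurve c₁)
    (hc₂ : IsSphericalCurve c₂) (T : E3 ≃ᵢ E3)
    (h : ∀ p, ruled a₁₁ a₀₂ c₂ p = T (ruled a₁₁ a₀₂ c₁ p)) :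
    Congruent (ruled a₁₁ a₀₂ c₁) (ruled a₁₁ a₀₂ c₂) := by
  have h0 : T 0 = 0 := by simpa [ruled_zero] using (h 0).symm
  have h' : ∀ p, ruled a₁₁ a₀₂ c₂ p =
    T.toRealLinearIsometryEquivOfMapZero h0 (ruled a₁₁ a₀₂ c₁ p) := h
  exact ⟨_, 0, det_eq_one_of_ruled_eq ha₀₂ hc₁ hc₂ h', fun p => by rw [add_zero, h']⟩

end Congruence

/-! ### `f₀` as the surface of a great circle -/

section GreatCircle

variable (a₁₁ : ℝ)

/-- The first vector of the frame in which the great circle of `f₀` is `(cos s, sin s, 0)`. -/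
def frameOne : E3 := !₂[1, 0, 0]

/-- The second vector of that frame. -/
def frameTwo : E3 := !₂[0, 1 / √(1 + a₁₁ ^ 2), a₁₁ / √(1 + a₁₁ ^ 2)]

/-- The great circle whose ruled surface is `f₀`. -/
def greatCircle (s : ℝ) : E3 := Real.cos s • frameOne + Real.sin s • frameTwo a₁₁

theorem inner_frameOne_frameOne : inner ℝ frameOne frameOne = (1 : ℝ) := by
  rw [inner_eq_sum]
  simp [frameOne]

theorem inner_frameOne_frameTwo : inner ℝ frameOne (frameTwo a₁₁) = (0 : ℝ) := by
  simp [inner_eq_sum, frameOne, frameTwo]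

theorem inner_frameTwo_frameTwo : inner ℝ (frameTwo a₁₁) (frameTwo a₁₁) = (1 : ℝ) := by
  have hk : √(1 + a₁₁ ^ 2) ^ 2 = 1 + a₁₁ ^ 2 := Real.sq_sqrt (by positivity)
  have hk0 : √(1 + a₁₁ ^ 2) ≠ 0 := (Real.sqrt_pos.2 (by positivity)).ne'
  simp only [inner_eq_sum, frameTwo, Matrix.cons_val]
  field_simp
  rw [hk]
  ring

/-- The derivative is kept in the shape of the original function so that the lemma applies again to
it. -/
theorem hasDerivAt_cos_smul_add_sin_smul (x y : E3) (s : ℝ) :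
    HasDerivAt (fun s => Real.cos s • x + Real.sin s • y)
      (Real.cos s • y + Real.sin s • -x) s := by
  refine (((Real.hasDerivAt_cos s).smul_const x).add
    ((Real.hasDerivAt_sin s).smul_const y)).congr_deriv ?_
  module

theorem norm_cos_smul_add_sin_smul {x y : E3} (hx : inner ℝ x x = (1 : ℝ))
    (hxy : inner ℝ x y = (0 : ℝ)) (hy : inner ℝ y y = (1 : ℝ)) (s : ℝ) :
    ‖Real.cos s • x + Real.sin s • y‖ = 1 := by
  rw [← sq_eq_sq₀ (norm_nonneg _) zero_le_one, ← real_inner_self_eq_norm_sq]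
  simp only [inner_add_left, inner_add_right, real_inner_smul_left, real_inner_smul_right, hx, hxy,
    hy, real_inner_comm x y]
  linear_combination Real.cos_sq_add_sin_sq s

theorem isSphericalCurve_greatCircle : IsSphericalCurve (greatCircle a₁₁) where
  smooth := by
    have h1 := Real.contDiff_cos (n := ∞)
    have h2 := Real.contDiff_sin (n := ∞)
    exact ((h1.smul contDiff_const).add (h2.smul contDiff_const)).contDiffOn
  mem_sphere s _ := by
    rw [mem_sphere_zero_iff_norm]
    exact norm_cos_smul_add_sin_smul inner_frameOne_frameOne (inner_frameOne_frameTwo a₁₁)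
      (inner_frameTwo_frameTwo a₁₁) s
  unit_speed s _ := by
    unfold greatCircle
    rw [(hasDerivAt_cos_smul_add_sin_smul _ _ s).deriv]
    exact norm_cos_smul_add_sin_smul (inner_frameTwo_frameTwo a₁₁)
      (by rw [inner_neg_right, real_inner_comm, inner_frameOne_frameTwo, neg_zero])
      (by rw [inner_neg_neg, inner_frameOne_frameOne]) s

theorem xi_greatCircle (v : ℝ) : xi a₁₁ (greatCircle a₁₁) v = !₂[1, v, a₁₁ * v] := by
  have hk0 : √(1 + a₁₁ ^ 2) ≠ 0 := (Real.sqrt_pos.2 (by positivity)).ne'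
  have hr0 := (Real.sqrt_pos.2 (one_add_mul_sq_pos a₁₁ v)).ne'
  have hr : 1 + (v * √(1 + a₁₁ ^ 2)) ^ 2 = 1 + (1 + a₁₁ ^ 2) * v ^ 2 := by
    rw [mul_pow, Real.sq_sqrt (by positivity)]
    ring
  simp only [xi, cHat, greatCircle, frameOne, frameTwo, Real.cos_arctan, Real.sin_arctan, hr]
  ext i
  fin_cases i
  · simp [hr0]
  · simp
    field_simp
  · simp
    field_simp

theorem ruled_greatCircle (a₀₂ : ℝ) : ruled a₁₁ a₀₂ (greatCircle a₁₁) = f₀ a₁₁ a₀₂ := by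
  have hk : 1 + a₁₁ ^ 2 ≠ 0 := by positivity
  have hd : ∀ v, deriv (xi a₁₁ (greatCircle a₁₁)) v = !₂[0, 1, a₁₁] := fun v => by
    have hx : xi a₁₁ (greatCircle a₁₁) = fun v => !₂[1, 0, 0] + v • !₂[0, 1, a₁₁] := by
      funext v
      rw [xi_greatCircle]
      ext i
      fin_cases i <;> simp [mul_comm]
    rw [hx]
    have := ((hasDerivAt_id v).smul_const (!₂[0, 1, a₁₁] : E3)).const_add !₂[1, 0, 0]
    rw [one_smul] at this
    exact this.deriv
  have hB : ∀ v, B a₁₁ (greatCircle a₁₁) v = !₂[0, 0, 1 + a₁₁ ^ 2] := fun v => by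
    rw [B, hd, xi_greatCircle, cross_eq]
    ext i
    fin_cases i <;> simp <;> ring
  funext p
  rw [ruled, gam, f₀, xi_greatCircle]
  simp only [hB]
  rw [intervalIntegral.integral_smul_const, integral_id]
  congr 1
  ext i
  fin_cases i
  · simp
  · simp
  · simp
    field_simp

end GreatCircle

/-! ### Geodesics of the sphere -/

section Geodesic

variable {a₁₁ a₀₂ : ℝ} {c : ℝ → E3}

theorem zero_mem_arcInterval : (0 : ℝ) ∈ arcInterval := by
  have := Real.pi_pos
  constructor <;> linarith

theorem IsSphericalCurve.hasDerivAt_deriv (hc : IsSphericalCurve c) {s : ℝ}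
    (hs : s ∈ arcInterval) : HasDerivAt (deriv c) (deriv (deriv c) s) s := by
  have h := (contDiffOn_infty_iff_deriv_of_isOpen isOpen_arcInterval).1 hc.smooth
  exact ((h.2.contDiffAt (isOpen_arcInterval.mem_nhds hs)).differentiableAt (by simp)).hasDerivAt

theorem IsSphericalCurve.inner_deriv_deriv_self (hc : IsSphericalCurve c) {s : ℝ}
    (hs : s ∈ arcInterval) : inner ℝ (deriv (deriv c) s) (c s) = (-1 : ℝ) := by
  have h1 := (hc.hasDerivAt hs).inner ℝ (hc.hasDerivAt_deriv hs)
  have h2 : (fun t => inner ℝ (c t) (deriv c t)) =ᶠ[𝓝 s] fun _ => (0 : ℝ) := by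
    filter_upwards [isOpen_arcInterval.mem_nhds hs] with t ht
    exact hc.inner_deriv ht
  have h3 := h1.unique ((hasDerivAt_const s (0 : ℝ)).congr_of_eventuallyEq h2)
  rw [hc.inner_deriv_deriv hs] at h3
  rw [real_inner_comm]
  linarith

theorem isSphericalGeodesic_iff (hc : IsSphericalCurve c) :
    IsSphericalGeodesic c ↔ ∀ s ∈ arcInterval, deriv (deriv c) s = -c s := by
  refine forall₂_congr fun s hs => ?_
  rw [hc.inner_deriv_deriv_self hs, neg_one_smul, sub_neg_eq_add, eq_neg_iff_add_eq_zero]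

/-- Rotating the pair `(c, c')` back by the angle `s` gives two vectors with zero derivative; they
keep their values at `0`. -/
theorem eq_cos_smul_add_sin_smul (hc : IsSphericalCurve c)
    (hg : ∀ s ∈ arcInterval, deriv (deriv c) s = -c s) {s : ℝ} (hs : s ∈ arcInterval) :
    c s = Real.cos s • c 0 + Real.sin s • deriv c 0 := by
  have hconst : ∀ {F : ℝ → E3}, (∀ t ∈ arcInterval, HasDerivAt F 0 t) → F s = F 0 :=
    fun {F} hF => isOpen_arcInterval.is_const_of_deriv_eq_zero isPreconnected_Ioo
      (fun t ht => (hF t ht).differentiableAt.differentiableWithinAt)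
      (fun t ht => (hF t ht).deriv) hs zero_mem_arcInterval
  have h1 := hconst (F := fun t => Real.cos t • c t - Real.sin t • deriv c t) fun t ht => by
    refine (((Real.hasDerivAt_cos t).smul (hc.hasDerivAt ht)).sub
      ((Real.hasDerivAt_sin t).smul (hc.hasDerivAt_deriv ht))).congr_deriv ?_
    rw [hg t ht]
    module
  have h2 := hconst (F := fun t => Real.sin t • c t + Real.cos t • deriv c t) fun t ht => by
    refine (((Real.hasDerivAt_sin t).smul (hc.hasDerivAt ht)).add
      ((Real.hasDerivAt_cos t).smul (hc.hasDerivAt_deriv ht))).congr_deriv ?_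
    rw [hg t ht]
    module
  simp only [Real.cos_zero, Real.sin_zero, one_smul, zero_smul, sub_zero, zero_add] at h1 h2
  rw [← h1, ← h2]
  have h3 : c s = (Real.cos s ^ 2 + Real.sin s ^ 2) • c s := by
    rw [Real.cos_sq_add_sin_sq, one_smul]
  refine h3.trans ?_
  module

theorem orthonormal_frame {x y : E3} (hx : inner ℝ x x = (1 : ℝ)) (hxy : inner ℝ x y = (0 : ℝ))
    (hy : inner ℝ y y = (1 : ℝ)) : Orthonormal ℝ ![x, y, cross x y] := by
  have hz : inner ℝ (cross x y) (cross x y) = (1 : ℝ) := by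
    rw [inner_cross_cross, hx, hxy, hy]
    norm_num
  rw [orthonormal_iff_ite]
  intro i j
  fin_cases i <;> fin_cases j <;>
    simp [hx, hxy, hy, hz, inner_left_cross, inner_right_cross, real_inner_comm x y,
      real_inner_comm x (cross x y), real_inner_comm y (cross x y),
      -inner_self_eq_norm_sq_to_K]

/-- Rotations act transitively on orthonormal pairs. -/
theorem exists_rotation {x y x' y' : E3} (hx : inner ℝ x x = (1 : ℝ))
    (hxy : inner ℝ x y = (0 : ℝ)) (hy : inner ℝ y y = (1 : ℝ)) (hx' : inner ℝ x' x' = (1 : ℝ))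
    (hxy' : inner ℝ x' y' = (0 : ℝ)) (hy' : inner ℝ y' y' = (1 : ℝ)) :
    ∃ A : E3 ≃ₗᵢ[ℝ] E3, LinearMap.det (A.toLinearEquiv : E3 →ₗ[ℝ] E3) = 1 ∧
      A x = x' ∧ A y = y' := by
  have ho := orthonormal_frame hx hxy hy
  have ho' := orthonormal_frame hx' hxy' hy'
  have hdim : Fintype.card (Fin 3) = Module.finrank ℝ E3 := by simp
  let b := OrthonormalBasis.mk ho
    (ho.linearIndependent.span_eq_top_of_card_eq_finrank' hdim).ge
  let b' := OrthonormalBasis.mk ho'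
    (ho'.linearIndependent.span_eq_top_of_card_eq_finrank' hdim).ge
  let A := b.equiv b' (Equiv.refl _)
  have hA : ∀ i, A (![x, y, cross x y] i) = ![x', y', cross x' y'] i := fun i => by
    have := b.equiv_apply_basis b' (Equiv.refl _) i
    simpa [b, b'] using this
  have h0 : A x = x' := hA 0
  have h1 : A y = y' := hA 1
  have h2 : A (cross x y) = cross x' y' := hA 2
  refine ⟨A, ?_, h0, h1⟩
  -- `A` takes `x × y` to `x' × y'`, a unit vector, so `cross_map` leaves only determinant `1`.
  have h3 := cross_map A x y
  rw [h0, h1, h2] at h3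
  have h4 := congrArg (inner ℝ (cross x' y')) h3
  rw [real_inner_smul_right, inner_cross_cross, hx', hy', hxy'] at h4
  linarith

theorem curveCongruent_greatCircle_iff (hc : IsSphericalCurve c) :
    CurveCongruent c (greatCircle a₁₁) ↔ IsSphericalGeodesic c := by
  rw [isSphericalGeodesic_iff hc]
  constructor
  · rintro ⟨A, -, h⟩ s hs
    have hcs : ∀ t ∈ arcInterval,
        c t = Real.cos t • A.symm frameOne + Real.sin t • A.symm (frameTwo a₁₁) := fun t ht => by
      rw [← map_smul, ← map_smul, ← map_add]
      exact (A.symm_apply_eq.2 (h t ht)).symm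
    have hd : ∀ t ∈ arcInterval, deriv c t =
        Real.cos t • A.symm (frameTwo a₁₁) + Real.sin t • -A.symm frameOne := fun t ht => by
      have he := Filter.eventuallyEq_of_mem (isOpen_arcInterval.mem_nhds ht) hcs
      rw [he.deriv_eq]
      exact (hasDerivAt_cos_smul_add_sin_smul _ _ t).deriv
    have he := Filter.eventuallyEq_of_mem (isOpen_arcInterval.mem_nhds hs) hd
    rw [he.deriv_eq, (hasDerivAt_cos_smul_add_sin_smul _ _ s).deriv, hcs s hs]
    module
  · intro hg
    obtain ⟨A, hA, h1, h2⟩ := exists_rotation (hc.inner_self zero_mem_arcInterval)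
      (hc.inner_deriv zero_mem_arcInterval) (hc.inner_deriv_deriv zero_mem_arcInterval)
      inner_frameOne_frameOne (inner_frameOne_frameTwo a₁₁) (inner_frameTwo_frameTwo a₁₁)
    refine ⟨A, hA, fun s hs => ?_⟩
    rw [eq_cos_smul_add_sin_smul hc hg hs, map_add, map_smul, map_smul, h1, h2, greatCircle]

end Geodesic

/-! ### Isometric deformations with `N` parameters -/

theorem contDiff_ruled_family {X : Type} [NormedAddCommGroup X] [NormedSpace ℝ X] [ProperSpace X]
    {c : X → ℝ → E3} (a₁₁ a₀₂ : ℝ) (hc : ContDiff ℝ ∞ fun q : X × ℝ => c q.1 q.2) :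
    ContDiff ℝ ∞ fun q : X × (ℝ × ℝ) => ruled a₁₁ a₀₂ (c q.1) q.2 := by
  let Ξ : X × ℝ → E3 := fun q => xi a₁₁ (c q.1) q.2
  have hcHat : ContDiff ℝ ∞ fun q : X × ℝ => cHat a₁₁ (c q.1) q.2 := by
    have h : ContDiff ℝ ∞ fun q : X × ℝ => Real.arctan (q.2 * √(1 + a₁₁ ^ 2)) :=
      Real.contDiff_arctan.comp (by fun_prop)
    exact hc.comp (contDiff_fst.prodMk h)
  have hΞ : ContDiff ℝ ∞ Ξ := ((contDiff_sqrt_one_add a₁₁).comp contDiff_snd).smul hcHat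
  -- Rewriting `ξ'` as a partial derivative of `Ξ` gives smoothness jointly in the parameter and
  -- `v`.
  have hd : ∀ q : X × ℝ, deriv (xi a₁₁ (c q.1)) q.2 = fderiv ℝ Ξ q (0, 1) := fun q => by
    have h1 : HasDerivAt (fun v : ℝ => (q.1, v)) ((0, 1) : X × ℝ) q.2 :=
      (hasDerivAt_const q.2 q.1).prodMk (hasDerivAt_id q.2)
    exact ((hΞ.differentiable (by simp) q).hasFDerivAt.comp_hasDerivAt q.2 h1).deriv
  have hΞ' : ContDiff ℝ ∞ fun q : X × ℝ => deriv (xi a₁₁ (c q.1)) q.2 := by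
    simp only [hd]
    exact (contDiff_infty_iff_fderiv.1 hΞ).2.clm_apply contDiff_const
  have hB : ContDiff ℝ ∞ fun q : X × ℝ => B a₁₁ (c q.1) q.2 :=
    (hΞ'.const_smul a₁₁).add (contDiff_cross hΞ hΞ')
  have hgam : ContDiff ℝ ∞ fun q : X × ℝ => gam a₁₁ a₀₂ (c q.1) q.2 :=
    (contDiff_parametric_primitive (F := fun q : X × ℝ => q.2 • B a₁₁ (c q.1) q.2)
      (contDiff_snd.smul hB)).const_smul _
  have hpr : ContDiff ℝ ∞ fun q : X × (ℝ × ℝ) => (q.1, q.2.2) := by fun_prop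
  exact (hgam.comp hpr).add
    ((contDiff_fst.comp contDiff_snd).smul (hΞ.comp hpr))

theorem hasDerivAt_parametric_primitive {X E : Type} [NormedAddCommGroup X]
    [NormedAddCommGroup E] [NormedSpace ℝ E] [CompleteSpace E] {F : X × ℝ → E}
    (hF : Continuous F) (x : X) (s : ℝ) :
    HasDerivAt (fun s => ∫ σ in (0 : ℝ)..s, F (x, σ)) (F (x, s)) s := by
  have h : Continuous fun σ => F (x, σ) := by fun_prop
  exact intervalIntegral.integral_hasDerivAt_right (h.intervalIntegrable _ _)
    (h.stronglyMeasurableAtFilter _ _) h.continuousAt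

section Family

variable {N : ℕ}

/-- The derivative of the latitude of the curves of the deformation: it vanishes for `s ≤ 0` and
determines the parameter `t`. -/
def latSlope (q : EuclideanSpace ℝ (Fin N) × ℝ) : ℝ :=
  Real.arctan (expNegInvGlue q.2 * ∑ i : Fin N, q.1 i * q.2 ^ (i : ℕ)) / (4 * (1 + q.2 ^ 2))

/-- The latitude of the curves of the deformation. -/
def latitude (q : EuclideanSpace ℝ (Fin N) × ℝ) : ℝ := ∫ s in (0 : ℝ)..q.2, latSlope (q.1, s)

/-- The derivative of the longitude that makes the curves of the deformation unit speed. -/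
def lonSlope (q : EuclideanSpace ℝ (Fin N) × ℝ) : ℝ := √(1 - latSlope q ^ 2) / Real.cos (latitude q)

/-- The longitude of the curves of the deformation. -/
def longitude (q : EuclideanSpace ℝ (Fin N) × ℝ) : ℝ := ∫ s in (0 : ℝ)..q.2, lonSlope (q.1, s)

/-- The curves of the deformation. -/
def deformedCircle (a₁₁ : ℝ) (t : EuclideanSpace ℝ (Fin N)) (s : ℝ) : E3 :=
  (Real.cos (latitude (t, s)) * Real.cos (longitude (t, s))) • frameOne +
    (Real.cos (latitude (t, s)) * Real.sin (longitude (t, s))) • frameTwo a₁₁ +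
      Real.sin (latitude (t, s)) • cross frameOne (frameTwo a₁₁)

theorem contDiff_latSlope : ContDiff ℝ ∞ (latSlope (N := N)) := by
  have h1 : ContDiff ℝ ∞ fun q : EuclideanSpace ℝ (Fin N) × ℝ => expNegInvGlue q.2 :=
    expNegInvGlue.contDiff.comp contDiff_snd
  refine ContDiff.div (Real.contDiff_arctan.comp (by fun_prop)) (by fun_prop) fun q => ?_
  positivity

/-- The bound serves twice: slope below `1` leaves room for unit speed, and its integral keeps the
curve away from the poles. -/
theorem abs_latSlope_le (q : EuclideanSpace ℝ (Fin N) × ℝ) :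
    |latSlope q| ≤ 1 / 2 * (1 / (1 + q.2 ^ 2)) := by
  have h1 := Real.pi_lt_four
  rw [latSlope, abs_div, abs_of_pos (by positivity : 0 < 4 * (1 + q.2 ^ 2))]
  have h2 : ∀ x, |Real.arctan x| ≤ 2 := fun x => by
    have h3 := Real.neg_pi_div_two_lt_arctan x
    have h4 := Real.arctan_lt_pi_div_two x
    exact abs_le.2 ⟨by linarith, by linarith⟩
  calc _ ≤ 2 / (4 * (1 + q.2 ^ 2)) := by
        gcongr
        exact h2 _
    _ = 1 / 2 * (1 / (1 + q.2 ^ 2)) := by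
        field_simp
        norm_num

theorem one_sub_latSlope_sq_pos (q : EuclideanSpace ℝ (Fin N) × ℝ) : 0 < 1 - latSlope q ^ 2 := by
  have h1 := abs_latSlope_le q
  have h2 : 1 / (1 + q.2 ^ 2) ≤ 1 := by
    rw [div_le_one (by positivity)]
    linarith [sq_nonneg q.2]
  have h3 : |latSlope q| < 1 := by linarith
  linarith [(sq_lt_one_iff_abs_lt_one _).2 h3]

theorem abs_latitude_lt (q : EuclideanSpace ℝ (Fin N) × ℝ) : |latitude q| < Real.pi / 2 := by
  have hc : Continuous fun s : ℝ => 1 / 2 * (1 / (1 + s ^ 2)) :=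
    continuous_const.mul (continuous_const.div (by fun_prop) fun s => by positivity)
  have h := intervalIntegral.norm_integral_le_abs_of_norm_le (a := 0) (b := q.2)
    (f := fun s => latSlope (q.1, s)) (μ := volume)
    (Eventually.of_forall fun s => abs_latSlope_le (q.1, s)) (hc.intervalIntegrable _ _)
  rw [intervalIntegral.integral_const_mul, integral_one_div_one_add_sq, Real.arctan_zero,
    sub_zero, abs_mul] at h
  have h2 : |Real.arctan q.2| < Real.pi / 2 :=
    abs_lt.2 ⟨Real.neg_pi_div_two_lt_arctan _, Real.arctan_lt_pi_div_two _⟩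
  have h3 : |(1 / 2 : ℝ)| = 1 / 2 := by norm_num
  rw [h3] at h
  have h4 := abs_nonneg (Real.arctan q.2)
  exact lt_of_le_of_lt h (by linarith)

theorem cos_latitude_pos (q : EuclideanSpace ℝ (Fin N) × ℝ) : 0 < Real.cos (latitude q) :=
  Real.cos_pos_of_mem_Ioo (abs_lt.1 (abs_latitude_lt q))

theorem contDiff_latitude : ContDiff ℝ ∞ (latitude (N := N)) :=
  contDiff_parametric_primitive contDiff_latSlope

theorem contDiff_lonSlope : ContDiff ℝ ∞ (lonSlope (N := N)) :=
  ((contDiff_const.sub (contDiff_latSlope.pow 2)).sqrt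
    fun q => (one_sub_latSlope_sq_pos q).ne').div
    (Real.contDiff_cos.comp contDiff_latitude) fun q => (cos_latitude_pos q).ne'

theorem contDiff_longitude : ContDiff ℝ ∞ (longitude (N := N)) :=
  contDiff_parametric_primitive contDiff_lonSlope

theorem contDiff_deformedCircle (a₁₁ : ℝ) :
    ContDiff ℝ ∞ fun q : EuclideanSpace ℝ (Fin N) × ℝ => deformedCircle a₁₁ q.1 q.2 := by
  have h1 := contDiff_latitude (N := N)
  have h2 := contDiff_longitude (N := N)
  have hc := Real.contDiff_cos (n := ∞)
  have hs := Real.contDiff_sin (n := ∞)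
  unfold deformedCircle
  fun_prop

theorem norm_sq_frame (a₁₁ x y z : ℝ) :
    ‖x • frameOne + y • frameTwo a₁₁ + z • cross frameOne (frameTwo a₁₁)‖ ^ 2 =
      x ^ 2 + y ^ 2 + z ^ 2 := by
  have hz : inner ℝ (cross frameOne (frameTwo a₁₁)) (cross frameOne (frameTwo a₁₁)) = (1 : ℝ) := by
    rw [inner_cross_cross, inner_frameOne_frameOne, inner_frameOne_frameTwo,
      inner_frameTwo_frameTwo]
    norm_num
  rw [← real_inner_self_eq_norm_sq]
  simp only [inner_add_left, inner_add_right, real_inner_smul_left, real_inner_smul_right,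
    inner_frameOne_frameOne, inner_frameOne_frameTwo, inner_frameTwo_frameTwo, hz,
    inner_left_cross, inner_right_cross, real_inner_comm frameOne (frameTwo a₁₁),
    real_inner_comm frameOne (cross _ _), real_inner_comm (frameTwo a₁₁) (cross _ _)]
  ring

theorem isSphericalCurve_deformedCircle (a₁₁ : ℝ) (t : EuclideanSpace ℝ (Fin N)) :
    IsSphericalCurve (deformedCircle a₁₁ t) where
  smooth := ((contDiff_deformedCircle (N := N) a₁₁).comp
    (contDiff_prodMk_right t)).contDiffOn
  mem_sphere s _ := by
    rw [mem_sphere_zero_iff_norm, ← sq_eq_sq₀ (norm_nonneg _) zero_le_one, deformedCircle,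
      norm_sq_frame]
    linear_combination Real.cos (latitude (t, s)) ^ 2 *
      Real.cos_sq_add_sin_sq (longitude (t, s)) + Real.cos_sq_add_sin_sq (latitude (t, s))
  unit_speed s _ := by
    have hh : HasDerivAt (fun s => latitude (t, s)) (latSlope (t, s)) s :=
      hasDerivAt_parametric_primitive contDiff_latSlope.continuous t s
    have hl : HasDerivAt (fun s => longitude (t, s)) (lonSlope (t, s)) s :=
      hasDerivAt_parametric_primitive contDiff_lonSlope.continuous t s
    have hd := (((hh.cos.mul hl.cos).smul_const frameOne).add
      ((hh.cos.mul hl.sin).smul_const (frameTwo a₁₁))).add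
      (hh.sin.smul_const (cross frameOne (frameTwo a₁₁)))
    have hd' : deriv (deformedCircle a₁₁ t) s = _ := hd.deriv
    rw [hd', ← sq_eq_sq₀ (norm_nonneg _) zero_le_one, norm_sq_frame]
    have hlon : (Real.cos (latitude (t, s)) * lonSlope (t, s)) ^ 2 = 1 - latSlope (t, s) ^ 2 := by
      rw [lonSlope, mul_div_cancel₀ _ (cos_latitude_pos _).ne',
        Real.sq_sqrt (one_sub_latSlope_sq_pos _).le]
    linear_combination hlon +
      (latSlope (t, s) ^ 2 * Real.sin (latitude (t, s)) ^ 2 +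
        (Real.cos (latitude (t, s)) * lonSlope (t, s)) ^ 2) *
          Real.cos_sq_add_sin_sq (longitude (t, s)) +
      latSlope (t, s) ^ 2 * Real.cos_sq_add_sin_sq (latitude (t, s))

theorem deformedCircle_eq_greatCircle (a₁₁ : ℝ) {t : EuclideanSpace ℝ (Fin N)} {s : ℝ}
    (h : ∀ σ ∈ uIcc 0 s, latSlope (t, σ) = 0) : deformedCircle a₁₁ t s = greatCircle a₁₁ s := by
  have hlat : ∀ σ ∈ uIcc 0 s, latitude (t, σ) = 0 := fun σ hσ =>
    (intervalIntegral.integral_congr fun τ hτ =>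
      h τ (uIcc_subset_uIcc_left hσ hτ)).trans intervalIntegral.integral_zero
  have hlon : longitude (t, s) = s := by
    have : longitude (t, s) = ∫ _ in (0 : ℝ)..s, (1 : ℝ) :=
      intervalIntegral.integral_congr fun σ hσ => by
        simp only [lonSlope, h σ hσ, hlat σ hσ]
        simp
    rw [this]
    simp
  rw [deformedCircle, hlat s right_mem_uIcc, hlon, greatCircle]
  simp

theorem deformedCircle_of_nonpos (a₁₁ : ℝ) (t : EuclideanSpace ℝ (Fin N)) {s : ℝ} (hs : s ≤ 0) :
    deformedCircle a₁₁ t s = greatCircle a₁₁ s := by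
  refine deformedCircle_eq_greatCircle a₁₁ fun σ hσ => ?_
  rw [uIcc_of_ge hs] at hσ
  simp [latSlope, expNegInvGlue.zero_of_nonpos hσ.2]

theorem deformedCircle_zero (a₁₁ : ℝ) :
    deformedCircle a₁₁ (0 : EuclideanSpace ℝ (Fin N)) = greatCircle a₁₁ := by
  funext s
  refine deformedCircle_eq_greatCircle a₁₁ fun σ _ => ?_
  simp [latSlope]

theorem eq_of_latSlope_eq {t t' : EuclideanSpace ℝ (Fin N)}
    (h : ∀ s ∈ arcInterval, latSlope (t, s) = latSlope (t', s)) : t = t' := by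
  let P : EuclideanSpace ℝ (Fin N) → Polynomial ℝ := fun t =>
    ∑ i : Fin N, Polynomial.C (t i) * Polynomial.X ^ (i : ℕ)
  have hP : P t = P t' := by
    -- For `0 < s < π / 2` the factor `expNegInvGlue s` is positive and can be cancelled.
    refine Polynomial.eq_of_infinite_eval_eq _ _
      ((Set.Ioo_infinite (half_pos Real.pi_pos)).mono fun s hs => ?_)
    have h1 := h s ⟨by linarith [hs.1, Real.pi_pos], hs.2⟩
    simp only [latSlope] at h1
    rw [div_left_inj' (by positivity), Real.arctan_inj,
      mul_right_inj' (expNegInvGlue.pos_of_pos hs.1).ne'] at h1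
    simpa [P, Polynomial.eval_finsetSum] using h1
  ext i
  have h2 := congrArg (fun p => Polynomial.coeff p i) hP
  simpa [P, Polynomial.finsetSum_coeff, Polynomial.coeff_X_pow, Fin.val_inj] using h2

/-- The common arc `s ≤ 0` makes `A` fix both frame vectors and, having determinant `1`, also their
vector product. Heights over the plane of the great circle therefore agree, and so do the latitudes
and their derivatives. -/
theorem eq_of_curveCongruent {a₁₁ : ℝ} {t t' : EuclideanSpace ℝ (Fin N)}
    (h : CurveCongruent (deformedCircle a₁₁ t) (deformedCircle a₁₁ t')) : t = t' := by
  obtain ⟨A, hA, hAc⟩ := h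
  have hpi := Real.pi_pos
  have hgc : ∀ s ∈ arcInterval, s ≤ 0 → greatCircle a₁₁ s = A (greatCircle a₁₁ s) :=
    fun s hs hs0 => by
      have := hAc s hs
      rwa [deformedCircle_of_nonpos a₁₁ t hs0, deformedCircle_of_nonpos a₁₁ t' hs0] at this
  have h1 : frameOne = A frameOne := by
    simpa [greatCircle] using hgc 0 zero_mem_arcInterval le_rfl
  have h2 : frameTwo a₁₁ = A (frameTwo a₁₁) := by
    -- Any negative parameter in the interval would do: its sine is nonzero, which isolates
    -- `frameTwo`.
    have := hgc (-(Real.pi / 4)) ⟨by linarith, by linarith⟩ (by linarith)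
    simp only [greatCircle, map_add, map_smul, ← h1, add_right_inj, Real.sin_neg,
      Real.sin_pi_div_four] at this
    exact smul_right_injective _ (neg_ne_zero.2 (by positivity)) this
  have h3 : cross frameOne (frameTwo a₁₁) = A (cross frameOne (frameTwo a₁₁)) := by
    have := cross_map A frameOne (frameTwo a₁₁)
    rwa [hA, one_smul, ← h1, ← h2] at this
  have hz : inner ℝ (cross frameOne (frameTwo a₁₁)) (cross frameOne (frameTwo a₁₁)) = (1 : ℝ) := by
    rw [inner_cross_cross, inner_frameOne_frameOne, inner_frameOne_frameTwo,
      inner_frameTwo_frameTwo]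
    norm_num
  have hin : ∀ (t : EuclideanSpace ℝ (Fin N)) s,
      inner ℝ (cross frameOne (frameTwo a₁₁)) (deformedCircle a₁₁ t s) =
        Real.sin (latitude (t, s)) := fun t s => by
    simp only [deformedCircle, inner_add_right, real_inner_smul_right, hz,
      real_inner_comm frameOne (cross _ _), real_inner_comm (frameTwo a₁₁) (cross _ _),
      inner_left_cross, inner_right_cross]
    ring
  have hlat : ∀ s ∈ arcInterval, latitude (t, s) = latitude (t', s) := fun s hs => by
    have h4 : Real.sin (latitude (t', s)) = Real.sin (latitude (t, s)) := by
      rw [← hin, ← hin, hAc s hs]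
      nth_rw 1 [h3]
      rw [A.inner_map_map]
    exact (Real.injOn_sin (abs_le.1 (abs_latitude_lt _).le) (abs_le.1 (abs_latitude_lt _).le)
      h4).symm
  refine eq_of_latSlope_eq fun s hs => ?_
  have hd : ∀ t : EuclideanSpace ℝ (Fin N),
      HasDerivAt (fun s => latitude (t, s)) (latSlope (t, s)) s := fun t =>
    hasDerivAt_parametric_primitive contDiff_latSlope.continuous t s
  refine (hd t).unique ((hd t').congr_of_eventuallyEq ?_)
  filter_upwards [isOpen_arcInterval.mem_nhds hs] with σ hσ
  exact hlat σ hσ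

end Family

end CrossCap

end

theorem theorem2p2 (a₁₁ a₀₂ : ℝ) (ha₀₂ : 0 < a₀₂) :
    -- `f_c` is smooth, has a cross cap at the origin, and is isometric to `f₀`
    (∀ c : ℝ → CrossCap.E3, CrossCap.IsSphericalCurve c →
      CrossCap.IsCrossCapAt (CrossCap.ruled a₁₁ a₀₂ c) 0 ∧
      CrossCap.IsIsometric (CrossCap.ruled a₁₁ a₀₂ c) (CrossCap.f₀ a₁₁ a₀₂)) ∧
    -- congruence of the surfaces is congruence of the spherical curves
    (∀ c₁ c₂ : ℝ → CrossCap.E3, CrossCap.IsSphericalCurve c₁ → CrossCap.IsSphericalCurve c₂ →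
      (CrossCap.Congruent (CrossCap.ruled a₁₁ a₀₂ c₁) (CrossCap.ruled a₁₁ a₀₂ c₂) ↔
        CrossCap.CurveCongruent c₁ c₂)) ∧
    -- surfaces that differ by any isometry of space are already congruent
    (∀ c₁ c₂ : ℝ → CrossCap.E3, CrossCap.IsSphericalCurve c₁ → CrossCap.IsSphericalCurve c₂ →
      (∃ T : CrossCap.E3 ≃ᵢ CrossCap.E3,
        ∀ p, CrossCap.ruled a₁₁ a₀₂ c₂ p = T (CrossCap.ruled a₁₁ a₀₂ c₁ p)) →
      CrossCap.Congruent (CrossCap.ruled a₁₁ a₀₂ c₁) (CrossCap.ruled a₁₁ a₀₂ c₂)) ∧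
    -- `f₀` corresponds to the geodesics
    (∀ c : ℝ → CrossCap.E3, CrossCap.IsSphericalCurve c →
      (CrossCap.Congruent (CrossCap.ruled a₁₁ a₀₂ c) (CrossCap.f₀ a₁₁ a₀₂) ↔
        CrossCap.IsSphericalGeodesic c)) ∧
    -- infinite-dimensional freedom: for every `N` there is an isometric deformation of `f₀` with
    -- `N` parameters through surfaces `f_c`, whose members are pairwise not congruent
    (∀ N : ℕ, ∃ c : EuclideanSpace ℝ (Fin N) → ℝ → CrossCap.E3,
      (∀ t, CrossCap.IsSphericalCurve (c t)) ∧
      CrossCap.ruled a₁₁ a₀₂ (c 0) = CrossCap.f₀ a₁₁ a₀₂ ∧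
      CrossCap.IsIsometricDeformation (fun t => CrossCap.ruled a₁₁ a₀₂ (c t)) ∧
      ∀ t t', CrossCap.Congruent (CrossCap.ruled a₁₁ a₀₂ (c t)) (CrossCap.ruled a₁₁ a₀₂ (c t')) →
        t = t') := by
  have hf₀ := CrossCap.ruled_greatCircle a₁₁ a₀₂
  have hgc := CrossCap.isSphericalCurve_greatCircle a₁₁
  refine ⟨fun c hc => ⟨CrossCap.isCrossCapAt_ruled_zero ha₀₂ hc, ?_⟩,
    fun c₁ c₂ hc₁ _ => CrossCap.congruent_ruled_iff hc₁,
    fun c₁ c₂ hc₁ hc₂ ⟨T, hT⟩ => CrossCap.congruent_of_isometryEquiv ha₀₂ hc₁ hc₂ T hT,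
    fun c hc => ?_, fun N => ⟨CrossCap.deformedCircle a₁₁,
      CrossCap.isSphericalCurve_deformedCircle a₁₁, ?_,
      ⟨CrossCap.contDiff_ruled_family a₁₁ a₀₂ (CrossCap.contDiff_deformedCircle a₁₁), fun t =>
        CrossCap.isIsometric_ruled ha₀₂ (CrossCap.isSphericalCurve_deformedCircle a₁₁ t)
          (CrossCap.isSphericalCurve_deformedCircle a₁₁ 0)⟩, fun t t' h => ?_⟩⟩
  · rw [← hf₀]
    exact CrossCap.isIsometric_ruled ha₀₂ hc hgc
  · rw [← hf₀, CrossCap.congruent_ruled_iff hc, CrossCap.curveCongruent_greatCircle_iff hc]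
  · rw [CrossCap.deformedCircle_zero, hf₀]
  · exact CrossCap.eq_of_curveCongruent ((CrossCap.congruent_ruled_iff
      (CrossCap.isSphericalCurve_deformedCircle a₁₁ t)).1 h)
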